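/- Let $m$ and $n$ be positive integers with $n\ge m$. Let $\psi=\Gamma'/\Gamma$ be the digamma function, $G=\sum_{k\ge0}\frac{(-1)^k}{(2k+1)^2}$ Catalan's constant, and $\mathrm{Li}_3$ the principal branch of the trilogarithm, i.e. the analytic continuation of $\sum_{k\ge1}z^k/k^3$ to $\mathbb{C}\setminus[1,\infty)$. Put $$\Theta_2(n,2m)=\sum_{k=1}^\infty(-1)^k\,\frac{\psi\left(\frac{2k+2n+5}{4}\right)-\psi\left(\frac{2k+2n+3}{4}\right)}{(2k+2m)^2},\qquad \Lambda=\operatorname{Im}\mathrm{Li}_3(1+i).$$ The series converges, and its value is as follows, with $d=n-m$ (an empty sum is $0$). (1) If $n=m$, then $$\Theta_2(n,2m)=(-1)^m\Bigl(-4-\sum_{k=1}^m\sum_{j=0}^{k}\frac{(-1)^j}{k^2(2j+1)}+\Bigl(1+\sum_{k=1}^m\frac1{4k^2}\Bigr)\pi+2\ln2-\frac{\pi}{4}\ln^22-\frac{\pi^2}{12}-\frac{5\pi^3}{48}-2G\ln2+4\Lambda\Bigr).$$ (2) If $n=m+1$, then $$\Theta_2(n,2m)=(-1)^m\Bigl(\frac{116}{27}+\sum_{k=1}^m\sum_{j=0}^{k+1}\frac{(-1)^j}{k^2(2j+1)}-\Bigl(\frac{10}{9}+\sum_{k=1}^m\frac1{4k^2}\Bigr)\pi-\frac{16\ln2}{9}+\frac{\pi}{4}\ln^22+\frac{\pi^2}{18}+\frac{5\pi^3}{48}+2G\ln2-4\Lambda\Bigr).$$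 (3) If $d$ is odd and $d\ne1$, then $$\begin{aligned}\Theta_2(n,2m)=(-1)^m\Bigl(&\frac{116}{27}-4\sum_{j=1}^{\frac{d-1}{2}}\frac1{(4j+3)^3}-\sum_{k=1}^m\sum_{j=0}^{k+d}\frac{(-1)^{j+d}}{k^2(2j+1)}+8\sum_{k=1}^{\frac{d-1}{2}}\sum_{j=0}^{2k}\frac{(-1)^j(16k^2+16k+5)}{(2j+1)(4k+3)^2(4k+1)^2}\\&+\Bigl(-\frac{10}{9}-\sum_{j=1}^{\frac{d-1}{2}}\frac{2(16j^2+16j+5)}{(4j+3)^2(4j+1)^2}+\frac14\ln^22+\sum_{k=1}^m\frac{(-1)^{d}}{4k^2}\Bigr)\pi\\&-\Bigl(\frac19+\sum_{j=1}^{\frac{d-1}{2}}\frac{2j+1}{(4j+3)^2(4j+1)^2}\Bigr)16\ln2\\&+\Bigl(\frac1{18}+\frac16\sum_{j=1}^{\frac{d-1}{2}}\frac1{(4j+3)(4j+1)}\Bigr)\pi^2+\frac{5\pi^3}{48}+2G\ln2-4\Lambda\Bigr).\end{aligned}$$ (4) If $d$ is even, then $$\begin{aligned}\Theta_2(n,2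m)=(-1)^m\Bigl(&-4-4\sum_{j=0}^{\frac{d-2}{2}}\frac1{(4j+5)^3}-\sum_{k=1}^m\sum_{j=0}^{k+d}\frac{(-1)^{j+d}}{k^2(2j+1)}-8\sum_{k=0}^{\frac{d-2}{2}}\sum_{j=0}^{2k+1}\frac{(-1)^j(16k^2+32k+17)}{(2j+1)(4k+5)^2(4k+3)^2}\\&+\Bigl(1+\sum_{j=0}^{\frac{d-2}{2}}\frac{2(16j^2+32j+17)}{(4j+5)^2(4j+3)^2}-\frac14\ln^22+\sum_{k=1}^m\frac{(-1)^{d}}{4k^2}\Bigr)\pi\\&+\Bigl(1-16\sum_{j=0}^{\frac{d-2}{2}}\frac{j+1}{(4j+5)^2(4j+3)^2}\Bigr)2\ln2\\&+\Bigl(-\frac12+\sum_{j=0}^{\frac{d-2}{2}}\frac1{(4j+5)(4j+3)}\Bigr)\frac{\pi^2}{6}-\frac{5\pi^3}{48}-2G\ln2+4\Lambda\Bigr).\end{aligned}$$ -/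

import Mathlib

noncomputable section

/-- Catalan's constant `G = ∑_{k ≥ 0} (-1)^k / (2k+1)^2` (an absolutely convergent series). -/
def catalanG : ℝ := ∑' k : ℕ, (-1 : ℝ) ^ k / (2 * (k : ℝ) + 1) ^ 2

/-- The principal branch of the trilogarithm `Li₃` on `ℂ ∖ [1, ∞)`, given by
`Li₃(z) = (z / 2) ∫₀¹ log² t / (1 - z t) dt`. It is the analytic continuation of
`∑_{k ≥ 1} z^k / k^3` from the unit disc to the slit plane: see `hasSum_trilog` and
`analyticOnNhd_trilog`. -/
def trilog (z : ℂ) : ℂ :=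
  z / 2 * ∫ t in (0 : ℝ)..1, ((Real.log t ^ 2 : ℝ) : ℂ) / (1 - z * (t : ℂ))

/-- The `k`-th term of the series `Θ₂(n, α)`, `k = 1, 2, 3, …`. -/
def theta2Term (n α k : ℕ) : ℂ :=
  (-1) ^ k * (Complex.digamma ((2 * (k : ℂ) + 2 * (n : ℂ) + 5) / 4)
      - Complex.digamma ((2 * (k : ℂ) + 2 * (n : ℂ) + 3) / 4)) / (2 * (k : ℂ) + (α : ℂ)) ^ 2

/-- `HasTheta2Sum n α s`: the series `Θ₂(n, α) = ∑_{k ≥ 1} theta2Term n α k` converges, with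
sum the real number `s`. -/
def HasTheta2Sum (n α : ℕ) (s : ℝ) : Prop :=
  HasSum (fun k : ℕ => theta2Term n α (k + 1)) (s : ℂ)

theorem continuous_pow_mul_log_sq (k : ℕ) :
    Continuous fun t : ℝ => t ^ (k + 1) * Real.log t ^ 2 := by
  have h1 : Continuous fun t : ℝ => t * Real.log t := Real.continuous_mul_log
  rcases Nat.eq_zero_or_pos k with rfl | hk
  · have h2 : (fun t : ℝ => t ^ (0 + 1) * Real.log t ^ 2) = fun t : ℝ =>
        4 * (SignType.sign t : ℝ) * (√|t| * Real.log √|t|) ^ 2 := by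
      funext t
      rw [Real.log_sqrt (abs_nonneg t), Real.log_abs]
      have : √|t| ^ 2 = |t| := Real.sq_sqrt (abs_nonneg t)
      have h3 : (SignType.sign t : ℝ) * |t| = t := sign_mul_abs t
      calc t ^ (0 + 1) * Real.log t ^ 2 = (SignType.sign t : ℝ) * |t| * Real.log t ^ 2 := by
            rw [h3]; ring
        _ = (SignType.sign t : ℝ) * √|t| ^ 2 * Real.log t ^ 2 := by rw [this]
        _ = _ := by ring
    rw [continuous_iff_continuousAt]
    intro t
    rcases eq_or_ne t 0 with rfl | ht
    · rw [h2]
      have h4 : Filter.Tendsto (fun t : ℝ => (√|t| * Real.log √|t|) ^ 2) (nhds 0) (nhds 0) := by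
        have : Continuous fun t : ℝ => (√|t| * Real.log √|t|) ^ 2 :=
          (h1.comp (Real.continuous_sqrt.comp continuous_abs)).pow 2
        simpa using this.tendsto 0
      have : Filter.Tendsto (fun t : ℝ => 4 * (SignType.sign t : ℝ) *
          (√|t| * Real.log √|t|) ^ 2) (nhds 0) (nhds 0) := by
        apply squeeze_zero_norm (a := fun t : ℝ => 4 * (√|t| * Real.log √|t|) ^ 2)
        · intro t
          rw [norm_mul, norm_mul]
          have : ‖(SignType.sign t : ℝ)‖ ≤ 1 := by
            rcases lt_trichotomy t 0 with h | h | h <;> simp [h]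
          have h5 : (0 : ℝ) ≤ (√|t| * Real.log √|t|) ^ 2 := sq_nonneg _
          rw [Real.norm_of_nonneg h5, Real.norm_of_nonneg (by norm_num : (0 : ℝ) ≤ 4)]
          nlinarith
        · simpa using h4.const_mul 4
      simpa [ContinuousAt] using this
    · exact (continuousAt_id.pow 1).mul ((Real.continuousAt_log ht).pow 2)
  · obtain ⟨j, rfl⟩ : ∃ j, k = j + 1 := ⟨k - 1, by omega⟩
    have h2 : (fun t : ℝ => t ^ (j + 1 + 1) * Real.log t ^ 2) = fun t : ℝ =>
        t ^ j * (t * Real.log t) ^ 2 := by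
      funext t; ring
    rw [h2]
    exact (continuous_pow j).mul (h1.pow 2)

theorem pow_mul_log_sq_integral (k : ℕ) :
    IntervalIntegrable (fun t : ℝ => t ^ k * Real.log t ^ 2) MeasureTheory.volume 0 1 ∧
      ∫ t in (0 : ℝ)..1, t ^ k * Real.log t ^ 2 = 2 / ((k : ℝ) + 1) ^ 3 := by
  set F : ℝ → ℝ := fun t => t ^ (k + 1) * Real.log t ^ 2 / (k + 1)
    - 2 * (t ^ k * (t * Real.log t)) / (k + 1) ^ 2 + 2 * t ^ (k + 1) / (k + 1) ^ 3 with hF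
  have hcont : Continuous F := by
    have h1 : Continuous fun t : ℝ => t * Real.log t := Real.continuous_mul_log
    exact (((continuous_pow_mul_log_sq k).div_const _).sub
      ((((continuous_pow k).mul h1).const_mul 2 |>.div_const _))).add
      (((continuous_pow (k + 1)).const_mul 2).div_const _)
  have hk : (k : ℝ) + 1 ≠ 0 := by positivity
  have hd : ∀ t ∈ Set.Ioo (0 : ℝ) 1, HasDerivAt F (t ^ k * Real.log t ^ 2) t := by
    intro t ht
    have ht0 : t ≠ 0 := ht.1.ne'
    have hl := Real.hasDerivAt_log ht0
    have hp := hasDerivAt_pow (k + 1) t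
    have hF' : F = fun t => t ^ (k + 1) * Real.log t ^ 2 / (k + 1)
        - 2 * (t ^ (k + 1) * Real.log t) / (k + 1) ^ 2 + 2 * t ^ (k + 1) / (k + 1) ^ 3 := by
      funext s; simp only [hF]; ring
    rw [hF']
    have := (((hp.mul (hl.pow 2)).div_const ((k : ℝ) + 1)).sub
      (((hp.mul hl).const_mul 2).div_const (((k : ℝ) + 1) ^ 2))).add
      ((hp.const_mul 2).div_const (((k : ℝ) + 1) ^ 3))
    refine this.congr_deriv ?_
    simp only [Nat.add_sub_cancel, Pi.pow_apply]
    push_cast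
    field_simp
    ring
  have hint : IntervalIntegrable (fun t : ℝ => t ^ k * Real.log t ^ 2)
      MeasureTheory.volume 0 1 := by
    apply intervalIntegral.intervalIntegrable_deriv_of_nonneg (g := F) hcont.continuousOn
    · intro t ht
      simp only [zero_le_one, inf_of_le_left, sup_of_le_right] at ht
      exact hd t ht
    · intro t ht
      simp only [zero_le_one, inf_of_le_left, sup_of_le_right] at ht
      exact mul_nonneg (pow_nonneg ht.1.le _) (sq_nonneg _)
  refine ⟨hint, ?_⟩
  rw [intervalIntegral.integral_eq_sub_of_hasDerivAt_of_le zero_le_one hcont.continuousOn hd hint]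
  simp [hF]

/-- On the unit disc, `trilog` is the sum of the defining power series of `Li₃`. -/
theorem hasSum_trilog {z : ℂ} (hz : ‖z‖ < 1) :
    HasSum (fun k : ℕ => z ^ (k + 1) / ((k : ℂ) + 1) ^ 3) (trilog z) := by
  have hlog : IntervalIntegrable (fun t : ℝ => Real.log t ^ 2) MeasureTheory.volume 0 1 := by
    simpa using (pow_mul_log_sq_integral 0).1
  have key : HasSum (fun k : ℕ => ∫ t in (0 : ℝ)..1,
        ((Real.log t ^ 2 : ℝ) : ℂ) * (z * (t : ℂ)) ^ k)
      (∫ t in (0 : ℝ)..1, ((Real.log t ^ 2 : ℝ) : ℂ) / (1 - z * (t : ℂ))) := by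
    apply intervalIntegral.hasSum_integral_of_dominated_convergence
      (bound := fun k t => Real.log t ^ 2 * ‖z‖ ^ k)
    · intro k
      apply Measurable.aestronglyMeasurable
      fun_prop
    · intro k
      refine Filter.Eventually.of_forall fun t ht => ?_
      rw [Set.uIoc_of_le zero_le_one] at ht
      rw [norm_mul, norm_pow, norm_mul, Complex.norm_real, Complex.norm_real,
        Real.norm_of_nonneg (sq_nonneg _), Real.norm_of_nonneg ht.1.le]
      exact mul_le_mul_of_nonneg_left (pow_le_pow_left₀ (mul_nonneg (norm_nonneg z) ht.1.le)
        (mul_le_of_le_one_right (norm_nonneg z) ht.2) k) (sq_nonneg _)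
    · refine Filter.Eventually.of_forall fun t _ => ?_
      exact (summable_geometric_of_lt_one (norm_nonneg _) hz).mul_left (Real.log t ^ 2)
    · simp_rw [tsum_mul_left]
      exact hlog.mul_const _
    · refine Filter.Eventually.of_forall fun t ht => ?_
      rw [Set.uIoc_of_le zero_le_one] at ht
      rw [div_eq_mul_inv]
      apply HasSum.mul_left
      apply hasSum_geometric_of_norm_lt_one
      rw [norm_mul, Complex.norm_real, Real.norm_of_nonneg ht.1.le]
      exact (mul_le_of_le_one_right (norm_nonneg z) ht.2).trans_lt hz
  have := key.mul_left (z / 2)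
  rw [show trilog z = z / 2 * ∫ t in (0 : ℝ)..1,
    ((Real.log t ^ 2 : ℝ) : ℂ) / (1 - z * (t : ℂ)) from rfl]
  refine (congrArg (fun f : ℕ → ℂ => HasSum f _) (funext fun k => ?_)).mpr this
  have h1 : ∀ t : ℝ, ((Real.log t ^ 2 : ℝ) : ℂ) * (z * (t : ℂ)) ^ k
      = z ^ k * ((t ^ k * Real.log t ^ 2 : ℝ) : ℂ) := by
    intro t; push_cast; ring
  simp_rw [h1]
  rw [intervalIntegral.integral_const_mul, intervalIntegral.integral_ofReal,
    (pow_mul_log_sq_integral k).2]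
  have : (k : ℂ) + 1 ≠ 0 := Nat.cast_add_one_ne_zero k
  push_cast
  field_simp
  ring

/-- `trilog` is holomorphic on the plane cut along `[1, ∞)`. -/
theorem analyticOnNhd_trilog : AnalyticOnNhd ℂ trilog {z | 1 - z ∈ Complex.slitPlane} := by
  have hlog : IntervalIntegrable (fun t : ℝ => Real.log t ^ 2) MeasureTheory.volume 0 1 := by
    simpa using (pow_mul_log_sq_integral 0).1
  have hopen : IsOpen {z : ℂ | 1 - z ∈ Complex.slitPlane} :=
    Complex.isOpen_slitPlane.preimage (by fun_prop)
  apply DifferentiableOn.analyticOnNhd _ hopen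
  intro z₀ hz₀
  refine DifferentiableAt.differentiableWithinAt ?_
  obtain ⟨ε, hε, hball⟩ := Metric.nhds_basis_closedBall.mem_iff.1 (hopen.mem_nhds hz₀)
  have hne : ∀ p ∈ Metric.closedBall z₀ ε ×ˢ Set.Icc (0 : ℝ) 1, 1 - p.1 * (p.2 : ℂ) ≠ 0 := by
    rintro ⟨z, t⟩ ⟨hz, ht⟩
    have h1 := Complex.starConvex_one_slitPlane (hball hz) (sub_nonneg.2 ht.2) ht.1 (by ring)
    have h2 : (1 - t) • (1 : ℂ) + t • (1 - z) = 1 - z * (t : ℂ) := by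
      simp only [Complex.real_smul]; push_cast; ring
    rw [h2] at h1
    exact Complex.slitPlane_ne_zero h1
  obtain ⟨c, hc, hcb⟩ : ∃ c > 0, ∀ p ∈ Metric.closedBall z₀ ε ×ˢ Set.Icc (0 : ℝ) 1,
      c ≤ ‖1 - p.1 * (p.2 : ℂ)‖ := by
    have hK : IsCompact (Metric.closedBall z₀ ε ×ˢ Set.Icc (0 : ℝ) 1) :=
      (isCompact_closedBall z₀ ε).prod isCompact_Icc
    obtain ⟨p, hp, hmin⟩ := hK.exists_isMinOn
      ⟨(z₀, 0), ⟨Metric.mem_closedBall_self hε.le, by simp⟩⟩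
      (f := fun p : ℂ × ℝ => ‖1 - p.1 * (p.2 : ℂ)‖) (by fun_prop)
    exact ⟨_, norm_pos_iff.2 (hne p hp), fun q hq => hmin hq⟩
  have hint : DifferentiableAt ℂ (fun z : ℂ => ∫ t in (0 : ℝ)..1,
      ((Real.log t ^ 2 : ℝ) : ℂ) / (1 - z * (t : ℂ))) z₀ := by
    refine (intervalIntegral.hasDerivAt_integral_of_dominated_loc_of_deriv_le
      (F' := fun z t => ((Real.log t ^ 2 : ℝ) : ℂ) * ((t : ℂ) / (1 - z * (t : ℂ)) ^ 2))
      (bound := fun t => Real.log t ^ 2 * (1 / c ^ 2))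
      (Metric.closedBall_mem_nhds z₀ hε) ?_ ?_ ?_ ?_ ?_ ?_).2.differentiableAt
    · refine Filter.Eventually.of_forall fun z => Measurable.aestronglyMeasurable ?_
      fun_prop
    · refine (hlog.mul_const (1 / c)).mono_fun (Measurable.aestronglyMeasurable (by fun_prop)) ?_
      refine (MeasureTheory.ae_restrict_iff' measurableSet_uIoc).2
        (Filter.Eventually.of_forall fun t ht => ?_)
      rw [Set.uIoc_of_le zero_le_one] at ht
      have := hcb (z₀, t) ⟨Metric.mem_closedBall_self hε.le, ht.1.le, ht.2⟩
      beta_reduce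
      rw [norm_div, Complex.norm_real, norm_mul, div_eq_mul_one_div,
        Real.norm_of_nonneg (one_div_pos.2 hc).le]
      gcongr
    · exact Measurable.aestronglyMeasurable (by fun_prop)
    · refine Filter.Eventually.of_forall fun t ht z hz => ?_
      rw [Set.uIoc_of_le zero_le_one] at ht
      have := hcb (z, t) ⟨hz, ht.1.le, ht.2⟩
      rw [norm_mul, norm_div, norm_pow, Complex.norm_real, Complex.norm_real,
        Real.norm_of_nonneg (sq_nonneg _), Real.norm_of_nonneg ht.1.le]
      gcongr
      exact ht.2
    · exact hlog.mul_const _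
    · refine Filter.Eventually.of_forall fun t ht z hz => ?_
      rw [Set.uIoc_of_le zero_le_one] at ht
      have h0 := hne (z, t) ⟨hz, ht.1.le, ht.2⟩
      have h1 : HasDerivAt (fun z : ℂ => 1 - z * (t : ℂ)) (-(t : ℂ)) z := by
        simpa using ((hasDerivAt_id z).mul_const (t : ℂ)).const_sub 1
      have h2 := (h1.inv h0).const_mul ((Real.log t ^ 2 : ℝ) : ℂ)
      simp only [neg_neg] at h2
      simpa only [div_eq_mul_inv] using! h2
  exact (differentiableAt_id.div_const 2).mul hint

end

/-! Write A_N = ∫₀¹ u^(2N)/(1+u²) du. Reflection and recurrence for ψ show that the digamma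
difference in each term of the series is 4·A_N for some N (`digamma_sub_eq_arctanMoment`). With K =
k + m and d = n - m, Θ₂(n, 2m) becomes (-1)^m times S(d+1) without its first m terms, where S(e) =
∑_{K≥1} (-1)^K A_{K+e} / K² (`momentSum`). Each A_N is ±(π/4 - Leibniz partial sum), so the removed
terms give the double sums over k ≤ m and part of the coefficient of π.

Since A_{N+1} + A_N = 1/(2N+1), the sum S(e+1) + S(e) is elementary by partial fractions
(`momentSum_succ`). Iterating expresses S(d+1) through ±S(0); the parity of d fixes the sign and
separates the cases.

The transcendental part is S(0) = ∫₀¹ Li₂(-u²)/(1+u²) du (`momentSum_zero`). With L = log(1+iu),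
arctan u = Im L and log(1+u²) = 2 Re L, so integration by parts leaves the imaginary part of ∫ L²/u.
This has an explicit primitive in Li₃(1+iu), Li₂(1+iu) and logarithms (`nielsenPrimitive`). Its
value at u = 1 needs Li₂(1+i), which Euler's reflection formula reduces to Li₂(-i), hence to
Catalan's constant. -/

section

open Filter Topology intervalIntegral

/-! ### Moments of 1/(1+u²) -/

/-- The moment `∫₀¹ u ^ (2 N) / (1 + u²) du`. -/
noncomputable def arctanMoment (N : ℕ) : ℝ := ∫ u in (0 : ℝ)..1, u ^ (2 * N) / (1 + u ^ 2)

theorem continuous_pow_div_one_add_sq (N : ℕ) :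
    Continuous fun u : ℝ => u ^ N / (1 + u ^ 2) :=
  (continuous_pow N).div (by fun_prop) fun u => by positivity

theorem arctanMoment_zero : arctanMoment 0 = Real.pi / 4 := by
  simp [arctanMoment]

theorem arctanMoment_succ (N : ℕ) :
    arctanMoment (N + 1) = 1 / (2 * (N : ℝ) + 1) - arctanMoment N := by
  rw [eq_sub_iff_add_eq, arctanMoment, arctanMoment, ← integral_add
    ((continuous_pow_div_one_add_sq _).intervalIntegrable _ _)
    ((continuous_pow_div_one_add_sq _).intervalIntegrable _ _)]
  have : ∀ u : ℝ, u ^ (2 * (N + 1)) / (1 + u ^ 2) + u ^ (2 * N) / (1 + u ^ 2) = u ^ (2 * N) := by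
    intro u
    have : 1 + u ^ 2 ≠ 0 := by positivity
    field_simp
    ring
  simp_rw [this, integral_pow]
  simp

/-- Partial sums of the Leibniz series for `π / 4`. -/
noncomputable def leibnizSum (N : ℕ) : ℝ := ∑ j ∈ Finset.range N, (-1 : ℝ) ^ j / (2 * (j : ℝ) + 1)

/-- The recurrence for the moments is that of the remainders of the Leibniz series, up to
alternating sign. -/
theorem arctanMoment_eq (N : ℕ) :
    arctanMoment N = (-1) ^ N * (Real.pi / 4 - leibnizSum N) := by
  induction N with
  | zero => simp [arctanMoment_zero, leibnizSum]
  | succ N ih =>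
    rw [arctanMoment_succ, ih, leibnizSum, leibnizSum, Finset.sum_range_succ, pow_succ]
    have : (-1 : ℝ) ^ N * (-1) ^ N = 1 := by rw [← mul_pow]; simp
    linear_combination (-1 / (2 * (N : ℝ) + 1)) * this

theorem arctanMoment_nonneg (N : ℕ) : 0 ≤ arctanMoment N :=
  integral_nonneg zero_le_one fun u hu => by
    have := hu.1
    positivity

theorem abs_arctanMoment_le (N : ℕ) : |arctanMoment N| ≤ 1 := by
  rw [abs_of_nonneg (arctanMoment_nonneg N)]
  cases N with
  | zero => rw [arctanMoment_zero]; linarith [Real.pi_lt_four]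
  | succ N =>
    have h : 1 / (2 * (N : ℝ) + 1) ≤ 1 := by
      rw [div_le_one (by positivity)]
      linarith [Nat.cast_nonneg (α := ℝ) N]
    rw [arctanMoment_succ]
    linarith [arctanMoment_nonneg N]

/-! ### Digamma differences as moments -/

/-- Logarithmic derivative of Γ(z)Γ(1-z) = π / sin πz. -/
theorem digamma_sub_digamma_one_sub {z : ℂ} (hz : ∀ k : ℤ, z ≠ k) :
    Complex.digamma (1 - z) - Complex.digamma z
      = Real.pi * Complex.cos (Real.pi * z) / Complex.sin (Real.pi * z) := by
  have hpi : (Real.pi : ℂ) ≠ 0 := by exact_mod_cast Real.pi_ne_zero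
  have hsin : Complex.sin (Real.pi * z) ≠ 0 := by
    rw [Complex.sin_ne_zero_iff]
    intro k h
    exact hz k (mul_left_cancel₀ hpi (by rw [h]; ring))
  have h1 : ∀ m : ℕ, z ≠ -m := fun m => by simpa using hz (-m)
  have h2 : ∀ m : ℕ, 1 - z ≠ -m := fun m h => hz (1 + m) (by push_cast; linear_combination -h)
  have g1 := Complex.Gamma_ne_zero h1
  have g2 := Complex.Gamma_ne_zero h2
  have d1 := (Complex.differentiableAt_Gamma z h1).hasDerivAt
  have d2 := (Complex.differentiableAt_Gamma (1 - z) h2).hasDerivAt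
  have d3 : HasDerivAt (fun w : ℂ => 1 - w) (-1) z := (hasDerivAt_id z).const_sub 1
  have dl := d1.mul (d2.comp z d3)
  have ds : HasDerivAt (fun w : ℂ => Complex.sin (Real.pi * w))
      (Complex.cos (Real.pi * z) * Real.pi) z := by
    have := ((hasDerivAt_id z).const_mul (Real.pi : ℂ)).csin
    simpa using! this
  have dr := (hasDerivAt_const z (Real.pi : ℂ)).div ds hsin
  have heq : (Complex.Gamma * (Complex.Gamma ∘ fun w : ℂ => 1 - w))
      = (fun _ => (Real.pi : ℂ)) / fun w : ℂ => Complex.sin (Real.pi * w) :=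
    funext fun w => Complex.Gamma_mul_Gamma_one_sub w
  rw [heq] at dl
  have hd := dl.unique dr
  have hg := Complex.Gamma_mul_Gamma_one_sub z
  simp only [Complex.digamma_def, logDeriv_apply, Function.comp_apply] at hd ⊢
  rw [eq_div_iff hsin] at hg ⊢
  rw [eq_div_iff (pow_ne_zero 2 hsin)] at hd
  rw [div_sub_div _ _ g2 g1, div_mul_eq_mul_div, div_eq_iff (mul_ne_zero g2 g1)]
  -- The differentiated identity carries sin² while the goal carries sin, so the goal is proved with
  -- an extra factor sin, which is then cancelled.
  have : Complex.sin (Real.pi * z) * (Complex.sin (Real.pi * z) *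
      (deriv Complex.Gamma (1 - z) * Complex.Gamma z - Complex.Gamma (1 - z) *
        deriv Complex.Gamma z)) = Complex.sin (Real.pi * z) * 
      (Complex.Gamma (1 - z) * Complex.Gamma z * Complex.cos (Real.pi * z) * Real.pi) := by
    linear_combination -hd - Real.pi * Complex.cos (Real.pi * z) * hg
  linear_combination mul_left_cancel₀ hsin this

theorem digamma_three_quarters_sub_digamma_quarter :
    Complex.digamma (3 / 4) - Complex.digamma (1 / 4) = Real.pi := by
  have h := digamma_sub_digamma_one_sub (z := 1 / 4) fun k hk => by
    have : (4 * k : ℂ) = 1 := by rw [← hk]; norm_num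
    have : 4 * k = 1 := by exact_mod_cast this
    omega
  rw [show (1 : ℂ) - 1 / 4 = 3 / 4 by norm_num] at h
  rw [h, show (Real.pi : ℂ) * (1 / 4) = ((Real.pi / 4 : ℝ) : ℂ) by push_cast; ring,
    ← Complex.ofReal_cos, ← Complex.ofReal_sin, Real.cos_pi_div_four, Real.sin_pi_div_four]
  have : ((√2 / 2 : ℝ) : ℂ) ≠ 0 := by
    rw [Complex.ofReal_ne_zero]
    positivity
  field_simp

/-- With x = (2N+1)/4, raising N by one turns the pair (x, x + 1/2) into (x + 1/2, x + 1). So ψ(x+1)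
= ψ(x) + 1/x gives four times the recurrence of the moments, and reflection at 1/4 gives the base
case. -/
theorem digamma_sub_eq_arctanMoment (N : ℕ) :
    Complex.digamma ((2 * (N : ℂ) + 3) / 4) - Complex.digamma ((2 * (N : ℂ) + 1) / 4)
      = 4 * (arctanMoment N : ℂ) := by
  induction N with
  | zero =>
    rw [arctanMoment_zero]
    simp only [Nat.cast_zero, mul_zero, zero_add]
    rw [digamma_three_quarters_sub_digamma_quarter]
    push_cast
    ring
  | succ N ih =>
    have hN : (2 * (N : ℂ) + 1) ≠ 0 := by exact_mod_cast Nat.succ_ne_zero (2 * N)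
    have h := Complex.digamma_apply_add_one ((2 * (N : ℂ) + 1) / 4) fun k hk => by
      have : 2 * (N : ℂ) + 1 + 4 * k = 0 := by linear_combination 4 * hk
      have : 2 * N + 1 + 4 * k = 0 := by exact_mod_cast this
      omega
    rw [arctanMoment_succ]
    push_cast
    rw [show (2 * ((N : ℂ) + 1) + 3) / 4 = (2 * (N : ℂ) + 1) / 4 + 1 by ring, h,
      show 2 * ((N : ℂ) + 1) + 1 = 2 * (N : ℂ) + 3 by ring]
    have : ((2 * (N : ℂ) + 1) / 4)⁻¹ = 4 * (1 / (2 * N + 1)) := by field_simp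
    linear_combination this - ih

/-! ### Classical alternating series -/

/-- The remainder is ±∫₀¹ uⁿ/(1+u) du. Convergence is only conditional, hence a limit of partial
sums instead of `HasSum`. -/
theorem tendsto_alternating_harmonic :
    Tendsto (fun n => ∑ k ∈ Finset.range n, (-1 : ℝ) ^ k / ((k : ℝ) + 1)) atTop
      (𝓝 (Real.log 2)) := by
  set r : ℕ → ℝ := fun n => ∫ u in (0 : ℝ)..1, u ^ n / (1 + u) with hr
  have hint : ∀ n : ℕ, IntervalIntegrable (fun u : ℝ => u ^ n / (1 + u))
      MeasureTheory.volume 0 1 := fun n => by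
    refine ContinuousOn.intervalIntegrable fun u hu => ?_
    rw [Set.uIcc_of_le zero_le_one] at hu
    have : 1 + u ≠ 0 := by linarith [hu.1]
    exact ContinuousAt.continuousWithinAt (by fun_prop (disch := exact this))
  have hrnn : ∀ n, 0 ≤ r n := fun n => integral_nonneg zero_le_one fun u hu => by
    have := hu.1
    positivity
  have hrs : ∀ n, r (n + 1) + r n = 1 / ((n : ℝ) + 1) := fun n => by
    rw [hr]
    simp only
    rw [← integral_add (hint _) (hint _)]
    have : Set.EqOn (fun u : ℝ => u ^ (n + 1) / (1 + u) + u ^ n / (1 + u)) (fun u => u ^ n)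
        (Set.uIcc 0 1) := fun u hu => by
      rw [Set.uIcc_of_le zero_le_one] at hu
      have : 1 + u ≠ 0 := by linarith [hu.1]
      simp only
      field_simp
      ring
    rw [integral_congr this, integral_pow]
    simp
  have hr0 : r 0 = Real.log 2 := by
    have := integral_comp_add_left (a := 0) (b := 1) (fun x : ℝ => 1 / x) 1
    simp only [hr, pow_zero]
    rw [this, integral_one_div_of_pos (by norm_num) (by norm_num)]
    norm_num
  have hsum : ∀ n, ∑ k ∈ Finset.range n, (-1 : ℝ) ^ k / ((k : ℝ) + 1)
      = Real.log 2 - (-1) ^ n * r n := fun n => by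
    induction n with
    | zero => simp [hr0]
    | succ n ih =>
      rw [Finset.sum_range_succ, ih, pow_succ]
      linear_combination (-1) ^ n * -hrs n
  simp_rw [hsum]
  have h0 : Tendsto (fun n => (-1 : ℝ) ^ n * r n) atTop (𝓝 0) := by
    refine squeeze_zero_norm (fun n => ?_) tendsto_one_div_add_atTop_nhds_zero_nat
    rw [norm_mul, norm_pow, norm_neg, norm_one, one_pow, one_mul, Real.norm_of_nonneg (hrnn n)]
    linarith [hrs n, hrnn (n + 1)]
  simpa using h0.const_sub (Real.log 2)

theorem summable_one_div_succ_sq : Summable fun k : ℕ => 1 / ((k : ℝ) + 1) ^ 2 := by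
  simpa using (summable_nat_add_iff 1).2 (Real.summable_one_div_nat_pow.2 one_lt_two)

theorem hasSum_one_div_succ_sq :
    HasSum (fun k : ℕ => 1 / ((k : ℝ) + 1) ^ 2) (Real.pi ^ 2 / 6) := by
  simpa using (hasSum_nat_add_iff' 1).2 hasSum_zeta_two

/-- If O is the sum over odd integers, then ζ(2) = O + ζ(2)/4 and the alternating sum is -O +
ζ(2)/4. -/
theorem hasSum_alternating_one_div_succ_sq :
    HasSum (fun k : ℕ => (-1 : ℝ) ^ (k + 1) / ((k : ℝ) + 1) ^ 2) (-Real.pi ^ 2 / 12) := by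
  have hs : Summable fun k : ℕ => (-1 : ℝ) ^ (k + 1) / ((k : ℝ) + 1) ^ 2 :=
    summable_one_div_succ_sq.of_norm_bounded fun k => by
      rw [norm_div, norm_pow, norm_neg, norm_one, one_pow, Real.norm_of_nonneg (by positivity)]
  have ho : Summable fun k : ℕ => 1 / (2 * (k : ℝ) + 1) ^ 2 := by
    have := summable_one_div_succ_sq.comp_injective (i := fun k : ℕ => 2 * k)
      fun a b h => by simpa using h
    simpa [Function.comp_def] using this
  have he : HasSum (fun k : ℕ => 1 / (2 * ((k : ℝ) + 1)) ^ 2) (Real.pi ^ 2 / 6 / 4) := by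
    refine (hasSum_one_div_succ_sq.div_const 4).congr_fun ?_
    intro k
    field_simp
    norm_num
  have e1 : HasSum (fun k : ℕ => 1 / ((k : ℝ) + 1) ^ 2)
      ((∑' k : ℕ, 1 / (2 * (k : ℝ) + 1) ^ 2) + Real.pi ^ 2 / 6 / 4) := by
    refine HasSum.even_add_odd ?_ ?_
    · simpa using ho.hasSum
    · refine he.congr_fun fun k => ?_
      push_cast; ring
  have e2 : HasSum (fun k : ℕ => (-1 : ℝ) ^ (k + 1) / ((k : ℝ) + 1) ^ 2)
      (-(∑' k : ℕ, 1 / (2 * (k : ℝ) + 1) ^ 2) + Real.pi ^ 2 / 6 / 4) := by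
    refine HasSum.even_add_odd ?_ ?_
    · refine ho.hasSum.neg.congr_fun fun k => ?_
      rw [pow_succ, pow_mul]
      push_cast
      norm_num
      ring
    · refine he.congr_fun fun k => ?_
      rw [show 2 * k + 1 + 1 = 2 * (k + 1) by ring, pow_mul]
      push_cast
      norm_num
      ring
  have := e1.unique hasSum_one_div_succ_sq
  convert e2 using 1
  linarith

/-! ### The sums S(e) and their recurrence -/

/-- The terms of `∑ (-1)^K / K² ∫₀¹ u^(2(K+e)) / (1+u²) du`, with `K = k + 1`. -/
noncomputable def momentTerm (e k : ℕ) : ℝ :=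
  (-1) ^ (k + 1) / ((k : ℝ) + 1) ^ 2 * arctanMoment (k + 1 + e)

noncomputable def momentSum (e : ℕ) : ℝ := ∑' k, momentTerm e k

theorem summable_momentTerm (e : ℕ) : Summable (momentTerm e) :=
  summable_one_div_succ_sq.of_norm_bounded fun k => by
    rw [momentTerm, norm_mul, norm_div, norm_pow, norm_neg, norm_one, one_pow,
      Real.norm_of_nonneg (by positivity)]
    exact mul_le_of_le_one_right (by positivity) (abs_arctanMoment_le _)

theorem hasSum_momentTerm (e : ℕ) : HasSum (momentTerm e) (momentSum e) :=
  (summable_momentTerm e).hasSum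

/-- With c = 2e+1, the sum of the two series has terms (-1)^K / (K²(2K+c)), and 1/(K²(2K+c)) =
1/(cK²) - 2/(c²K) + 4/(c²(2K+c)). The last two pieces converge only conditionally, so partial sums
are compared. -/
theorem momentSum_succ (e : ℕ) :
    momentSum (e + 1) = -momentSum e - Real.pi ^ 2 / 12 / (2 * (e : ℝ) + 1)
      + 2 * Real.log 2 / (2 * (e : ℝ) + 1) ^ 2
      + 4 / (2 * (e : ℝ) + 1) ^ 2 * ((-1) ^ e * (Real.pi / 4 - leibnizSum (e + 1))) := by
  have hc : 2 * (e : ℝ) + 1 ≠ 0 := by positivity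
  have h1 := ((hasSum_momentTerm (e + 1)).add (hasSum_momentTerm e)).tendsto_sum_nat
  -- The denominators 2K + 2e + 1 with K ≥ 1 are those of the Leibniz series from index e + 1 on;
  -- (-1)^e corrects the sign.
  have hR : Tendsto (fun n => ∑ k ∈ Finset.range n, (-1 : ℝ) ^ (k + 1) /
      (2 * ((k : ℝ) + 1 + e) + 1)) atTop (𝓝 ((-1) ^ e * (Real.pi / 4 - leibnizSum (e + 1)))) := by
    have h := ((((tendsto_add_atTop_iff_nat (e + 1)).2 Real.tendsto_sum_pi_div_four).sub_const
      (leibnizSum (e + 1))).const_mul ((-1 : ℝ) ^ e))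
    refine h.congr fun n => ?_
    rw [add_comm n, Finset.sum_range_add, leibnizSum, add_sub_cancel_left, Finset.mul_sum]
    refine Finset.sum_congr rfl fun k _ => ?_
    rw [← mul_div_assoc, ← pow_add, show e + (e + 1 + k) = 2 * e + (k + 1) by ring, pow_add,
      pow_mul]
    push_cast
    norm_num
    congr 1
    ring
  have h2 := ((hasSum_alternating_one_div_succ_sq.tendsto_sum_nat.div_const (2 * (e : ℝ) + 1)).add
    (tendsto_alternating_harmonic.const_mul (2 / (2 * (e : ℝ) + 1) ^ 2))).add
    (hR.const_mul (4 / (2 * (e : ℝ) + 1) ^ 2))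
  have h3 := tendsto_nhds_unique h1 (h2.congr fun n => ?_)
  · linear_combination h3
  rw [Finset.sum_div, Finset.mul_sum, Finset.mul_sum, ← Finset.sum_add_distrib,
    ← Finset.sum_add_distrib]
  refine Finset.sum_congr rfl fun k _ => ?_
  rw [momentTerm, momentTerm, show k + 1 + (e + 1) = k + 1 + e + 1 by ring, arctanMoment_succ]
  push_cast
  have h4 : 2 * ((k : ℝ) + 1 + e) + 1 ≠ 0 := by positivity
  have h5 : (k : ℝ) + 1 ≠ 0 := by positivity
  rw [pow_succ]
  field_simp
  ring

/-! ### Reduction of Θ₂ to S(d+1) -/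

/-- In terms of K = k + m + 1 the denominator is 4K², the moment index is K + d + 1, and the sign is
(-1)^m (-1)^K; the 4 cancels. -/
theorem theta2Term_eq (m d k : ℕ) :
    theta2Term (m + d) (2 * m) (k + 1)
      = (((-1) ^ m * momentTerm (d + 1) (k + m) : ℝ) : ℂ) := by
  have h := digamma_sub_eq_arctanMoment (k + m + 1 + (d + 1))
  rw [theta2Term, momentTerm]
  push_cast at h ⊢
  rw [show (2 * ((k : ℂ) + 1) + 2 * (m + d) + 5) / 4
      = (2 * ((k : ℂ) + m + 1 + (d + 1)) + 3) / 4 by ring,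
    show (2 * ((k : ℂ) + 1) + 2 * (m + d) + 3) / 4
      = (2 * ((k : ℂ) + m + 1 + (d + 1)) + 1) / 4 by ring, h]
  have h5 : (k : ℂ) + m + 1 ≠ 0 := by exact_mod_cast Nat.succ_ne_zero (k + m)
  have h6 : (-1 : ℂ) ^ m * (-1) ^ (k + m + 1) = (-1) ^ (k + 1) := by
    rw [← pow_add, show m + (k + m + 1) = 2 * m + (k + 1) by ring, pow_add, pow_mul]
    norm_num
  rw [← h6, show 2 * ((k : ℂ) + 1) + 2 * m = 2 * (k + m + 1) by ring]
  field_simp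
  ring

theorem hasTheta2Sum_momentSum (m d : ℕ) :
    HasTheta2Sum (m + d) (2 * m)
      ((-1) ^ m * (momentSum (d + 1) - ∑ k ∈ Finset.range m, momentTerm (d + 1) k)) := by
  rw [HasTheta2Sum]
  simp_rw [theta2Term_eq]
  rw [Complex.hasSum_ofReal]
  exact ((hasSum_nat_add_iff' m).2 (hasSum_momentTerm (d + 1))).mul_left _

/-- In (-1)^K A_{K+d+1} the K-dependence of the sign cancels, leaving -(-1)^d (π/4 - Leibniz sum up
to j = K + d). -/
theorem sum_momentTerm (m d : ℕ) :
    ∑ k ∈ Finset.range m, momentTerm (d + 1) k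
      = ∑ k ∈ Finset.Icc 1 m, ∑ j ∈ Finset.Icc 0 (k + d),
            (-1 : ℝ) ^ (j + d) / ((k : ℝ) ^ 2 * (2 * (j : ℝ) + 1))
        - (∑ k ∈ Finset.Icc 1 m, (-1 : ℝ) ^ d / (4 * (k : ℝ) ^ 2)) * Real.pi := by
  induction m with
  | zero => simp
  | succ m ih =>
    rw [Finset.sum_range_succ, Finset.sum_Icc_succ_top (by omega), Finset.sum_Icc_succ_top (by omega),
      ih]
    have h : ∑ j ∈ Finset.Icc 0 (m + 1 + d),
        (-1 : ℝ) ^ (j + d) / (((m + 1 : ℕ) : ℝ) ^ 2 * (2 * (j : ℝ) + 1))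
          = (-1) ^ d / ((m : ℝ) + 1) ^ 2 * leibnizSum (m + 1 + d + 1) := by
      rw [leibnizSum, Finset.mul_sum, ← Nat.range_succ_eq_Icc_zero]
      refine Finset.sum_congr rfl fun j _ => ?_
      rw [div_mul_div_comm, pow_add]
      push_cast
      ring
    have h2 : (-1 : ℝ) ^ (m + 1) * (-1) ^ (m + 1 + (d + 1)) = -(-1) ^ d := by
      rw [← pow_add, show m + 1 + (m + 1 + (d + 1)) = 2 * (m + 1) + (d + 1) by ring, pow_add,
        pow_mul, pow_succ]
      norm_num [pow_succ]
    rw [h, momentTerm, arctanMoment_eq, show m + 1 + d + 1 = m + 1 + (d + 1) by ring]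
    push_cast
    have h3 : (-1 : ℝ) ^ d / (4 * ((m : ℝ) + 1) ^ 2) = (-1) ^ d / ((m : ℝ) + 1) ^ 2 / 4 := by
      rw [div_div, mul_comm (4 : ℝ)]
    rw [h3]
    linear_combination ((Real.pi / 4 - leibnizSum (m + 1 + (d + 1))) / ((m : ℝ) + 1) ^ 2) * h2

/-! ### Solving the recurrence, by parity -/

theorem leibnizSum_succ (N : ℕ) :
    leibnizSum (N + 1) = leibnizSum N + (-1) ^ N / (2 * (N : ℝ) + 1) :=
  Finset.sum_range_succ _ _

theorem sum_Icc_leibniz (N : ℕ) (a b c : ℝ) :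
    ∑ j ∈ Finset.Icc 0 N, (-1 : ℝ) ^ j * a / ((2 * (j : ℝ) + 1) * b * c)
      = a / (b * c) * leibnizSum (N + 1) := by
  rw [leibnizSum, Finset.mul_sum, ← Nat.range_succ_eq_Icc_zero]
  refine Finset.sum_congr rfl fun j _ => ?_
  rw [div_mul_div_comm]
  ring

/-- Raising r by one applies the recurrence twice, which preserves the sign of S(0). The two steps
contribute the denominators c = 4r+3 and c = 4r+5. -/
theorem momentSum_two_mul_add_one (r : ℕ) :
    momentSum (2 * r + 1) = -4
        - 4 * ∑ j ∈ Finset.range r, 1 / (4 * (j : ℝ) + 5) ^ 3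
        - 8 * ∑ k ∈ Finset.range r, ∑ j ∈ Finset.Icc 0 (2 * k + 1),
            (-1 : ℝ) ^ j * (16 * (k : ℝ) ^ 2 + 32 * (k : ℝ) + 17)
              / ((2 * (j : ℝ) + 1) * (4 * (k : ℝ) + 5) ^ 2 * (4 * (k : ℝ) + 3) ^ 2)
        + (1 + ∑ j ∈ Finset.range r,
                2 * (16 * (j : ℝ) ^ 2 + 32 * (j : ℝ) + 17)
                  / ((4 * (j : ℝ) + 5) ^ 2 * (4 * (j : ℝ) + 3) ^ 2)) * Real.pi
        + (1 - 16 * ∑ j ∈ Finset.range r,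
              ((j : ℝ) + 1) / ((4 * (j : ℝ) + 5) ^ 2 * (4 * (j : ℝ) + 3) ^ 2))
            * (2 * Real.log 2)
        + (-(1 / 2) + ∑ j ∈ Finset.range r,
              1 / ((4 * (j : ℝ) + 5) * (4 * (j : ℝ) + 3))) * (Real.pi ^ 2 / 6)
        - momentSum 0 := by
  simp_rw [sum_Icc_leibniz]
  induction r with
  | zero =>
    rw [mul_zero, momentSum_succ]
    simp [leibnizSum]
    ring
  | succ r ih =>
    have h1 := momentSum_succ (2 * r + 1)
    have h2 := momentSum_succ (2 * r + 2)
    have hl := leibnizSum_succ (2 * r + 2)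
    rw [Odd.neg_one_pow ⟨r, rfl⟩] at h1
    rw [Even.neg_one_pow ⟨r + 1, by ring⟩] at h2 hl
    push_cast at h1 h2 hl
    rw [show 2 * (2 * (r : ℝ) + 1) + 1 = 4 * r + 3 by ring] at h1
    rw [show 2 * (2 * (r : ℝ) + 2) + 1 = 4 * r + 5 by ring] at h2 hl
    simp only [Finset.sum_range_succ]
    have h3 : 4 * (r : ℝ) + 3 ≠ 0 := by positivity
    have h5 : 4 * (r : ℝ) + 5 ≠ 0 := by positivity
    -- The rational summands of the closed form are the sums and differences of the contributions of
    -- the two steps. The cubes 1/(4r+5)³ come from the last term of the longer Leibniz sum.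
    have e1 : (16 * (r : ℝ) ^ 2 + 32 * r + 17) / ((4 * r + 5) ^ 2 * (4 * r + 3) ^ 2)
        = (1 / (4 * r + 3) ^ 2 + 1 / (4 * r + 5) ^ 2) / 2 := by field_simp; ring
    have e2 : ((r : ℝ) + 1) / ((4 * r + 5) ^ 2 * (4 * r + 3) ^ 2)
        = (1 / (4 * r + 3) ^ 2 - 1 / (4 * r + 5) ^ 2) / 16 := by field_simp; ring
    have e3 : 1 / ((4 * (r : ℝ) + 5) * (4 * r + 3))
        = (1 / (4 * r + 3) - 1 / (4 * r + 5)) / 2 := by field_simp; ring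
    have e4 : 1 / (4 * (r : ℝ) + 5) ^ 3 = 1 / (4 * r + 5) * (1 / (4 * r + 5) ^ 2) := by
      field_simp
    rw [mul_div_assoc, e1, e2, e3, e4, show 2 * (r + 1) + 1 = 2 * r + 2 + 1 by ring, h2, h1, ih, hl]
    ring

/-- Same double step from S(2); 116/27, 10/9, 1/9 and 1/18 come from the recurrence at e = 0 and e =
1. -/
theorem momentSum_two_mul_add_two (r : ℕ) :
    momentSum (2 * r + 2) = 116 / 27
        - 4 * ∑ j ∈ Finset.Icc 1 r, 1 / (4 * (j : ℝ) + 3) ^ 3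
        + 8 * ∑ k ∈ Finset.Icc 1 r, ∑ j ∈ Finset.Icc 0 (2 * k),
            (-1 : ℝ) ^ j * (16 * (k : ℝ) ^ 2 + 16 * (k : ℝ) + 5)
              / ((2 * (j : ℝ) + 1) * (4 * (k : ℝ) + 3) ^ 2 * (4 * (k : ℝ) + 1) ^ 2)
        + (-(10 / 9) - ∑ j ∈ Finset.Icc 1 r,
                2 * (16 * (j : ℝ) ^ 2 + 16 * (j : ℝ) + 5)
                  / ((4 * (j : ℝ) + 3) ^ 2 * (4 * (j : ℝ) + 1) ^ 2)) * Real.pi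
        - (1 / 9 + ∑ j ∈ Finset.Icc 1 r,
              (2 * (j : ℝ) + 1) / ((4 * (j : ℝ) + 3) ^ 2 * (4 * (j : ℝ) + 1) ^ 2))
            * (16 * Real.log 2)
        + (1 / 18 + 1 / 6 * ∑ j ∈ Finset.Icc 1 r,
              1 / ((4 * (j : ℝ) + 3) * (4 * (j : ℝ) + 1))) * Real.pi ^ 2
        + momentSum 0 := by
  simp_rw [sum_Icc_leibniz]
  induction r with
  | zero =>
    rw [mul_zero, momentSum_succ, momentSum_succ]
    simp [leibnizSum, Finset.sum_range_succ]
    ring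
  | succ r ih =>
    have h1 := momentSum_succ (2 * r + 2)
    have h2 := momentSum_succ (2 * r + 3)
    have hl := leibnizSum_succ (2 * r + 3)
    rw [Even.neg_one_pow ⟨r + 1, by ring⟩] at h1
    rw [Odd.neg_one_pow ⟨r + 1, by ring⟩] at h2 hl
    push_cast at h1 h2 hl
    rw [show 2 * (2 * (r : ℝ) + 2) + 1 = 4 * r + 5 by ring] at h1
    rw [show 2 * (2 * (r : ℝ) + 3) + 1 = 4 * r + 7 by ring] at h2 hl
    simp only [Finset.sum_Icc_succ_top (show 1 ≤ r + 1 by omega)]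
    push_cast
    rw [show 4 * ((r : ℝ) + 1) + 3 = 4 * r + 7 by ring,
      show 4 * ((r : ℝ) + 1) + 1 = 4 * r + 5 by ring]
    have h5 : 4 * (r : ℝ) + 5 ≠ 0 := by positivity
    have h7 : 4 * (r : ℝ) + 7 ≠ 0 := by positivity
    have e1 : (16 * ((r : ℝ) + 1) ^ 2 + 16 * (r + 1) + 5) / ((4 * r + 7) ^ 2 * (4 * r + 5) ^ 2)
        = (1 / (4 * r + 5) ^ 2 + 1 / (4 * r + 7) ^ 2) / 2 := by field_simp; ring
    have e2 : (2 * ((r : ℝ) + 1) + 1) / ((4 * r + 7) ^ 2 * (4 * r + 5) ^ 2)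
        = (1 / (4 * r + 5) ^ 2 - 1 / (4 * r + 7) ^ 2) / 8 := by field_simp; ring
    have e3 : 1 / ((4 * (r : ℝ) + 7) * (4 * r + 5))
        = (1 / (4 * r + 5) - 1 / (4 * r + 7)) / 2 := by field_simp; ring
    have e4 : 1 / (4 * (r : ℝ) + 7) ^ 3 = 1 / (4 * r + 7) * (1 / (4 * r + 7) ^ 2) := by
      field_simp
    rw [mul_div_assoc, e1, e2, e3, e4, show 2 * (r + 1) + 2 = 2 * r + 3 + 1 by ring, h2, h1,
      ih, hl, show 2 * (r + 1) + 1 = 2 * r + 2 + 1 by ring]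
    ring

/-! ### Dilogarithm and trilogarithm off the cut -/

/-- The dilogarithm `Li₂(z) = -z ∫₀¹ log t / (1 - z t) dt`. -/
noncomputable def dilog (z : ℂ) : ℂ :=
  -z * ∫ t in (0 : ℝ)..1, (Real.log t : ℂ) / (1 - z * (t : ℂ))

theorem intervalIntegrable_log_sq :
    IntervalIntegrable (fun t : ℝ => Real.log t ^ 2) MeasureTheory.volume 0 1 := by
  simpa using (pow_mul_log_sq_integral 0).1

/-- From log t ≥ 1 - 1/t; it controls the integrals at t = 1 when z reaches the branch point. -/
theorem mul_abs_log_div_one_sub_le {t : ℝ} (h0 : 0 < t) (h1 : t < 1) :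
    t * |Real.log t| / (1 - t) ≤ 1 := by
  rw [div_le_one (by linarith), abs_of_neg (Real.log_neg h0 h1)]
  have := Real.one_sub_inv_le_log_of_pos h0
  have h2 : t * t⁻¹ = 1 := mul_inv_cancel₀ h0.ne'
  nlinarith

theorem intervalIntegrable_abs_log_div_one_sub :
    IntervalIntegrable (fun t : ℝ => |Real.log t| / (1 - t)) MeasureTheory.volume 0 1 := by
  refine (intervalIntegrable_log'.abs.add (intervalIntegrable_const (c := (1 : ℝ)))).mono_fun
    (Measurable.aestronglyMeasurable (by fun_prop)) ?_
  refine (MeasureTheory.ae_restrict_iff' measurableSet_uIoc).2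
    (Filter.Eventually.of_forall fun t ht => ?_)
  rw [Set.uIoc_of_le zero_le_one] at ht
  rcases ht.2.eq_or_lt with rfl | h1
  · simp
  have h2 : 0 < 1 - t := by linarith
  beta_reduce
  rw [Real.norm_of_nonneg (by positivity), Real.norm_of_nonneg (by positivity)]
  have := mul_abs_log_div_one_sub_le ht.1 h1
  have h3 : |Real.log t| / (1 - t) = |Real.log t| + t * |Real.log t| / (1 - t) := by
    field_simp; ring
  linarith [sq_abs (Real.log t)]

theorem intervalIntegrable_log_sq_div_one_sub :
    IntervalIntegrable (fun t : ℝ => |Real.log t ^ 2| / (1 - t)) MeasureTheory.volume 0 1 := by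
  refine (intervalIntegrable_log_sq.add intervalIntegrable_log'.abs).mono_fun
    (Measurable.aestronglyMeasurable (by fun_prop)) ?_
  refine (MeasureTheory.ae_restrict_iff' measurableSet_uIoc).2
    (Filter.Eventually.of_forall fun t ht => ?_)
  rw [Set.uIoc_of_le zero_le_one] at ht
  rcases ht.2.eq_or_lt with rfl | h1
  · simp
  have h2 : 0 < 1 - t := by linarith
  beta_reduce
  rw [Real.norm_of_nonneg (by positivity), Real.norm_of_nonneg (by positivity), abs_pow]
  have := mul_le_mul_of_nonneg_left (mul_abs_log_div_one_sub_le ht.1 h1) (abs_nonneg (Real.log t))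
  have h3 : |Real.log t| ^ 2 / (1 - t)
      = |Real.log t| ^ 2 + |Real.log t| * (t * |Real.log t| / (1 - t)) := by
    field_simp; ring
  linarith [sq_abs (Real.log t)]

theorem one_sub_mul_mem_slitPlane {z : ℂ} (hz : 1 - z ∈ Complex.slitPlane) {t : ℝ}
    (h0 : 0 ≤ t) (h1 : t ≤ 1) : 1 - z * (t : ℂ) ∈ Complex.slitPlane := by
  have h := Complex.starConvex_one_slitPlane hz (sub_nonneg.2 h1) h0 (by ring)
  have h2 : (1 - t) • (1 : ℂ) + t • (1 - z) = 1 - z * (t : ℂ) := by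
    simp only [Complex.real_smul]; push_cast; ring
  rwa [h2] at h

theorem intervalIntegrable_ofReal_mul {g : ℝ → ℝ} {h : ℝ → ℂ}
    (hg : IntervalIntegrable g MeasureTheory.volume 0 1) (hh : ContinuousOn h (Set.Icc 0 1)) :
    IntervalIntegrable (fun t => (g t : ℂ) * h t) MeasureTheory.volume 0 1 := by
  refine IntervalIntegrable.mul_continuousOn ?_ (by rwa [Set.uIcc_of_le zero_le_one])
  rw [intervalIntegrable_iff] at hg ⊢
  exact hg.ofReal

theorem continuousOn_one_sub_mul_inv {z : ℂ} (hz : 1 - z ∈ Complex.slitPlane) :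
    ContinuousOn (fun t : ℝ => (1 - z * (t : ℂ))⁻¹) (Set.Icc 0 1) :=
  ContinuousOn.inv₀ (by fun_prop) fun _ ht =>
    Complex.slitPlane_ne_zero (one_sub_mul_mem_slitPlane hz ht.1 ht.2)

/-- Differentiation of `z ∫₀¹ g(t) / (1 - z t) dt` off the cut `[1, ∞)`. -/
theorem hasDerivAt_mul_integral_div_one_sub {g : ℝ → ℝ} (hm : Measurable g)
    (hg : IntervalIntegrable g MeasureTheory.volume 0 1) {z₀ : ℂ}
    (hz₀ : 1 - z₀ ∈ Complex.slitPlane) :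
    HasDerivAt (fun z : ℂ => z * ∫ t in (0 : ℝ)..1, (g t : ℂ) / (1 - z * (t : ℂ)))
      (∫ t in (0 : ℝ)..1, (g t : ℂ) / (1 - z₀ * (t : ℂ)) ^ 2) z₀ := by
  have hopen : IsOpen {z : ℂ | 1 - z ∈ Complex.slitPlane} :=
    Complex.isOpen_slitPlane.preimage (by fun_prop)
  obtain ⟨ε, hε, hball⟩ := Metric.nhds_basis_closedBall.mem_iff.1 (hopen.mem_nhds hz₀)
  have hne : ∀ p ∈ Metric.closedBall z₀ ε ×ˢ Set.Icc (0 : ℝ) 1, 1 - p.1 * (p.2 : ℂ) ≠ 0 := by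
    rintro ⟨z, t⟩ ⟨hz, ht⟩
    exact Complex.slitPlane_ne_zero (one_sub_mul_mem_slitPlane (hball hz) ht.1 ht.2)
  obtain ⟨c, hc, hcb⟩ : ∃ c > 0, ∀ p ∈ Metric.closedBall z₀ ε ×ˢ Set.Icc (0 : ℝ) 1,
      c ≤ ‖1 - p.1 * (p.2 : ℂ)‖ := by
    have hK : IsCompact (Metric.closedBall z₀ ε ×ˢ Set.Icc (0 : ℝ) 1) :=
      (isCompact_closedBall z₀ ε).prod isCompact_Icc
    obtain ⟨p, hp, hmin⟩ := hK.exists_isMinOn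
      ⟨(z₀, 0), ⟨Metric.mem_closedBall_self hε.le, by simp⟩⟩
      (f := fun p : ℂ × ℝ => ‖1 - p.1 * (p.2 : ℂ)‖) (by fun_prop)
    exact ⟨_, norm_pos_iff.2 (hne p hp), fun q hq => hmin hq⟩
  have hi := continuousOn_one_sub_mul_inv hz₀
  have hint0 := intervalIntegrable_ofReal_mul hg hi
  have hint := intervalIntegral.hasDerivAt_integral_of_dominated_loc_of_deriv_le
      (F := fun (z : ℂ) (t : ℝ) => (g t : ℂ) / (1 - z * (t : ℂ)))
      (F' := fun z t => (g t : ℂ) * ((t : ℂ) / (1 - z * (t : ℂ)) ^ 2))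
      (bound := fun t => |g t| * (1 / c ^ 2)) (a := 0) (b := 1) (μ := MeasureTheory.volume)
      (Metric.closedBall_mem_nhds z₀ hε)
      (Filter.Eventually.of_forall fun z => Measurable.aestronglyMeasurable (by fun_prop))
      (by simpa only [div_eq_mul_inv] using hint0)
      (Measurable.aestronglyMeasurable (by fun_prop))
      (Filter.Eventually.of_forall fun t ht z hz => by
        rw [Set.uIoc_of_le zero_le_one] at ht
        have := hcb (z, t) ⟨hz, ht.1.le, ht.2⟩
        rw [norm_mul, norm_div, norm_pow, Complex.norm_real, Complex.norm_real,
          Real.norm_eq_abs, Real.norm_of_nonneg ht.1.le]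
        gcongr
        exact ht.2)
      (hg.abs.mul_const _)
      (Filter.Eventually.of_forall fun t ht z hz => by
        rw [Set.uIoc_of_le zero_le_one] at ht
        have h0 := hne (z, t) ⟨hz, ht.1.le, ht.2⟩
        have h1 : HasDerivAt (fun z : ℂ => 1 - z * (t : ℂ)) (-(t : ℂ)) z := by
          simpa using ((hasDerivAt_id z).mul_const (t : ℂ)).const_sub 1
        have h2 := (h1.inv h0).const_mul (g t : ℂ)
        simp only [neg_neg] at h2
        simpa only [div_eq_mul_inv] using! h2)
  refine ((hasDerivAt_id z₀).mul hint.2).congr_deriv ?_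
  simp only [id, one_mul]
  rw [← integral_const_mul, ← integral_add (by simpa only [div_eq_mul_inv] using hint0)
    (hint.1.const_mul _)]
  refine integral_congr fun t ht => ?_
  rw [Set.uIcc_of_le zero_le_one] at ht
  have := Complex.slitPlane_ne_zero (one_sub_mul_mem_slitPlane hz₀ ht.1 ht.2)
  field_simp
  ring

theorem hasDerivAt_id_div_one_sub_mul {z : ℂ} {t : ℝ} (h : 1 - z * (t : ℂ) ≠ 0) :
    HasDerivAt (fun s : ℝ => (1 - z * (s : ℂ))⁻¹) (z / (1 - z * (t : ℂ)) ^ 2) t := by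
  have h1 : HasDerivAt (fun s : ℝ => 1 - z * (s : ℂ)) (-z) t := by
    simpa using ((Complex.ofRealCLM.hasDerivAt (x := t)).const_mul z).const_sub 1
  simpa using! h1.inv h

/-- Integration by parts: t log t / (1 - zt) vanishes at both ends, and its derivative is the sum of
the two integrands. -/
theorem integral_log_div_one_sub_sq {z : ℂ} (hz : 1 - z ∈ Complex.slitPlane) :
    ∫ t in (0 : ℝ)..1, (Real.log t : ℂ) / (1 - z * (t : ℂ)) ^ 2
      = -∫ t in (0 : ℝ)..1, 1 / (1 - z * (t : ℂ)) := by
  have hi := continuousOn_one_sub_mul_inv hz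
  have i1 : IntervalIntegrable (fun t : ℝ => 1 / (1 - z * (t : ℂ))) MeasureTheory.volume 0 1 := by
    simp only [one_div]
    exact hi.intervalIntegrable_of_Icc zero_le_one
  have i2 : IntervalIntegrable (fun t : ℝ => (Real.log t : ℂ) / (1 - z * (t : ℂ)) ^ 2)
      MeasureTheory.volume 0 1 := by
    simpa only [div_eq_mul_inv, inv_pow, Pi.pow_apply]
      using intervalIntegrable_ofReal_mul intervalIntegrable_log' (hi.pow 2)
  have key := integral_eq_sub_of_hasDerivAt_of_le
    (f := fun t : ℝ => ((t * Real.log t : ℝ) : ℂ) * (1 - z * (t : ℂ))⁻¹)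
    (f' := fun t : ℝ => (Real.log t : ℂ) / (1 - z * (t : ℂ)) ^ 2 + 1 / (1 - z * (t : ℂ)))
    zero_le_one
    ((Complex.continuous_ofReal.comp Real.continuous_mul_log).continuousOn.mul hi)
    (fun t ht => by
      have h0 := Complex.slitPlane_ne_zero (one_sub_mul_mem_slitPlane hz ht.1.le ht.2.le)
      refine (((Real.hasDerivAt_mul_log ht.1.ne').ofReal_comp).mul
        (hasDerivAt_id_div_one_sub_mul h0)).congr_deriv ?_
      push_cast
      field_simp
      ring) (i2.add i1)
  rw [integral_add i2 i1] at key
  rw [eq_neg_iff_add_eq_zero]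
  simpa using key

/-- As before, with t log² t / (1 - zt). -/
theorem integral_log_sq_div_one_sub_sq {z : ℂ} (hz : 1 - z ∈ Complex.slitPlane) :
    ∫ t in (0 : ℝ)..1, ((Real.log t ^ 2 : ℝ) : ℂ) / (1 - z * (t : ℂ)) ^ 2
      = -2 * ∫ t in (0 : ℝ)..1, (Real.log t : ℂ) / (1 - z * (t : ℂ)) := by
  have hi := continuousOn_one_sub_mul_inv hz
  have i1 : IntervalIntegrable (fun t : ℝ => (Real.log t : ℂ) / (1 - z * (t : ℂ)))
      MeasureTheory.volume 0 1 := by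
    simpa only [div_eq_mul_inv] using intervalIntegrable_ofReal_mul intervalIntegrable_log' hi
  have i2 : IntervalIntegrable (fun t : ℝ => ((Real.log t ^ 2 : ℝ) : ℂ) / (1 - z * (t : ℂ)) ^ 2)
      MeasureTheory.volume 0 1 := by
    simpa only [div_eq_mul_inv, inv_pow, Pi.pow_apply]
      using intervalIntegrable_ofReal_mul intervalIntegrable_log_sq (hi.pow 2)
  have hc : Continuous fun t : ℝ => t * Real.log t ^ 2 := by simpa using continuous_pow_mul_log_sq 0
  have key := integral_eq_sub_of_hasDerivAt_of_le
    (f := fun t : ℝ => ((t * Real.log t ^ 2 : ℝ) : ℂ) * (1 - z * (t : ℂ))⁻¹)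
    (f' := fun t : ℝ => ((Real.log t ^ 2 : ℝ) : ℂ) / (1 - z * (t : ℂ)) ^ 2
      + 2 * ((Real.log t : ℂ) / (1 - z * (t : ℂ))))
    zero_le_one ((Complex.continuous_ofReal.comp hc).continuousOn.mul hi)
    (fun t ht => by
      have h0 := Complex.slitPlane_ne_zero (one_sub_mul_mem_slitPlane hz ht.1.le ht.2.le)
      have ht0 : (t : ℂ) ≠ 0 := by exact_mod_cast ht.1.ne'
      refine ((((hasDerivAt_id t).mul ((Real.hasDerivAt_log ht.1.ne').pow 2)).ofReal_comp).mul
        (hasDerivAt_id_div_one_sub_mul h0)).congr_deriv ?_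
      simp
      field_simp
      ring) (i2.add (i1.const_mul 2))
  rw [integral_add i2 (i1.const_mul 2), integral_const_mul] at key
  rw [neg_mul, eq_neg_iff_add_eq_zero]
  simpa using key

theorem integral_one_div_one_sub {z : ℂ} (hz : 1 - z ∈ Complex.slitPlane) (h0 : z ≠ 0) :
    ∫ t in (0 : ℝ)..1, 1 / (1 - z * (t : ℂ)) = -Complex.log (1 - z) / z := by
  have hi := continuousOn_one_sub_mul_inv hz
  have key := integral_eq_sub_of_hasDerivAt
    (f := fun t : ℝ => -Complex.log (1 - z * (t : ℂ)) / z)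
    (f' := fun t : ℝ => 1 / (1 - z * (t : ℂ))) (a := 0) (b := 1)
    (fun t ht => by
      rw [Set.uIcc_of_le zero_le_one] at ht
      have hs := one_sub_mul_mem_slitPlane hz ht.1 ht.2
      have h1 : HasDerivAt (fun s : ℝ => 1 - z * (s : ℂ)) (-z) t := by
        simpa using ((Complex.ofRealCLM.hasDerivAt (x := t)).const_mul z).const_sub 1
      refine ((h1.clog_real hs).neg.div_const z).congr_deriv ?_
      have := Complex.slitPlane_ne_zero hs
      field_simp)
    (by
      simp only [one_div]
      exact hi.intervalIntegrable_of_Icc zero_le_one)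
  rw [key]
  simp

theorem hasDerivAt_dilog {z : ℂ} (hz : 1 - z ∈ Complex.slitPlane) (h0 : z ≠ 0) :
    HasDerivAt dilog (-Complex.log (1 - z) / z) z := by
  have h := (hasDerivAt_mul_integral_div_one_sub Real.measurable_log intervalIntegrable_log' hz).neg
  rw [integral_log_div_one_sub_sq hz, neg_neg, integral_one_div_one_sub hz h0] at h
  have he : dilog = -fun z : ℂ => z * ∫ t in (0 : ℝ)..1, (Real.log t : ℂ) / (1 - z * (t : ℂ)) := by
    funext z
    simp [dilog]
  rwa [he]

theorem hasDerivAt_trilog {z : ℂ} (hz : 1 - z ∈ Complex.slitPlane) (h0 : z ≠ 0) :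
    HasDerivAt trilog (dilog z / z) z := by
  have h := (hasDerivAt_mul_integral_div_one_sub (Real.measurable_log.pow_const 2)
    intervalIntegrable_log_sq hz).div_const 2
  rw [integral_log_sq_div_one_sub_sq hz] at h
  have he : trilog = fun z : ℂ => (z * ∫ t in (0 : ℝ)..1,
      ((Real.log t ^ 2 : ℝ) : ℂ) / (1 - z * (t : ℂ))) / 2 := by
    funext z
    rw [trilog]
    ring
  rw [he]
  refine h.congr_deriv ?_
  rw [dilog]
  field_simp

/-! ### Behaviour at the branch point and special values -/

/-- Continuity up to the branch point `1` along curves on which `|1 - γ t| ≥ 1 - t`. -/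
theorem continuousOn_integral_div_one_sub {g : ℝ → ℝ} (hm : Measurable g)
    (hg : IntervalIntegrable (fun t => |g t| / (1 - t)) MeasureTheory.volume 0 1) {γ : ℝ → ℂ}
    (hγ : Continuous γ)
    (hb : ∀ u ∈ Set.Icc (0 : ℝ) 1, ∀ t ∈ Set.Ioo (0 : ℝ) 1, 1 - t ≤ ‖1 - γ u * (t : ℂ)‖) :
    ContinuousOn (fun u => ∫ t in (0 : ℝ)..1, (g t : ℂ) / (1 - γ u * (t : ℂ)))
      (Set.Icc 0 1) := by
  intro u₀ hu₀
  have hae : ∀ᵐ t : ℝ, t ∉ ({1} : Set ℝ) := (Set.countable_singleton 1).ae_notMem _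
  refine continuousWithinAt_of_dominated_interval (bound := fun t => |g t| / (1 - t))
    (Filter.Eventually.of_forall fun u => Measurable.aestronglyMeasurable (by fun_prop))
    ?_ hg ?_
  · filter_upwards [self_mem_nhdsWithin] with u hu
    filter_upwards [hae] with t ht1 ht
    rw [Set.uIoc_of_le zero_le_one] at ht
    have h1 : t < 1 := lt_of_le_of_ne ht.2 ht1
    rw [norm_div, Complex.norm_real, Real.norm_eq_abs]
    exact div_le_div_of_nonneg_left (abs_nonneg _) (by linarith) (hb u hu t ⟨ht.1, h1⟩)
  · filter_upwards [hae] with t ht1 ht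
    rw [Set.uIoc_of_le zero_le_one] at ht
    have h1 : t < 1 := lt_of_le_of_ne ht.2 ht1
    have h2 : 1 - γ u₀ * (t : ℂ) ≠ 0 := norm_pos_iff.1
      (lt_of_lt_of_le (by linarith) (hb u₀ hu₀ t ⟨ht.1, h1⟩))
    exact ContinuousAt.continuousWithinAt (by fun_prop (disch := exact h2))

theorem continuousOn_dilog_comp {γ : ℝ → ℂ} (hγ : Continuous γ)
    (hb : ∀ u ∈ Set.Icc (0 : ℝ) 1, ∀ t ∈ Set.Ioo (0 : ℝ) 1, 1 - t ≤ ‖1 - γ u * (t : ℂ)‖) :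
    ContinuousOn (fun u => dilog (γ u)) (Set.Icc 0 1) :=
  hγ.neg.continuousOn.mul (continuousOn_integral_div_one_sub Real.measurable_log
    intervalIntegrable_abs_log_div_one_sub hγ hb)

theorem continuousOn_trilog_comp {γ : ℝ → ℂ} (hγ : Continuous γ)
    (hb : ∀ u ∈ Set.Icc (0 : ℝ) 1, ∀ t ∈ Set.Ioo (0 : ℝ) 1, 1 - t ≤ ‖1 - γ u * (t : ℂ)‖) :
    ContinuousOn (fun u => trilog (γ u)) (Set.Icc 0 1) :=
  (hγ.div_const 2).continuousOn.mul (continuousOn_integral_div_one_sub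
    (Real.measurable_log.pow_const 2) intervalIntegrable_log_sq_div_one_sub hγ hb)

theorem one_sub_le_norm_one_sub_mul {z : ℂ} (hz : ‖z‖ ≤ 1) {t : ℝ} (ht : 0 ≤ t) :
    1 - t ≤ ‖1 - z * (t : ℂ)‖ := by
  have h := norm_sub_norm_le (1 : ℂ) (z * (t : ℂ))
  rw [norm_one, norm_mul, Complex.norm_real, Real.norm_of_nonneg ht] at h
  linarith [mul_le_of_le_one_left ht hz]

/-- On the line Re z = 1 the real part of 1 - zt is exactly 1 - t. -/
theorem one_sub_le_norm_one_sub_one_add_mul_I (u : ℝ) (t : ℝ) :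
    1 - t ≤ ‖1 - (1 + u * Complex.I) * (t : ℂ)‖ := by
  refine le_trans ?_ (Complex.re_le_norm _)
  simp

theorem integral_pow_mul_log (k : ℕ) :
    ∫ t in (0 : ℝ)..1, t ^ k * Real.log t = -1 / ((k : ℝ) + 1) ^ 2 := by
  have hk : (k : ℝ) + 1 ≠ 0 := by positivity
  have h := integral_eq_sub_of_hasDerivAt_of_le
    (f := fun t : ℝ => t ^ k * (t * Real.log t) / (k + 1) - t ^ (k + 1) / (k + 1) ^ 2)
    (f' := fun t : ℝ => t ^ k * Real.log t) zero_le_one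
    ((((continuous_pow k).mul Real.continuous_mul_log).div_const _).sub
      ((continuous_pow (k + 1)).div_const _)).continuousOn
    (fun t ht => by
      have ht0 : t ≠ 0 := ht.1.ne'
      have h1 := (((hasDerivAt_pow (k + 1) t).mul (Real.hasDerivAt_log ht0)).div_const
        ((k : ℝ) + 1)).sub ((hasDerivAt_pow (k + 1) t).div_const (((k : ℝ) + 1) ^ 2))
      have h2 : (fun t : ℝ => t ^ k * (t * Real.log t) / (k + 1) - t ^ (k + 1) / (k + 1) ^ 2)
          = fun t : ℝ => t ^ (k + 1) * Real.log t / (k + 1) - t ^ (k + 1) / (k + 1) ^ 2 := by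
        funext s
        ring
      rw [h2]
      refine h1.congr_deriv ?_
      simp only [Nat.add_sub_cancel]
      push_cast
      field_simp
      ring)
    (intervalIntegrable_log'.continuousOn_mul (continuous_pow k).continuousOn)
  rw [h]
  simp
  field_simp

/-- The defining power series of the dilogarithm, on the closed unit disc. -/
theorem hasSum_dilog {z : ℂ} (hz : ‖z‖ ≤ 1) :
    HasSum (fun k : ℕ => z ^ (k + 1) / ((k : ℂ) + 1) ^ 2) (dilog z) := by
  have hae : ∀ᵐ t : ℝ, t ∉ ({1} : Set ℝ) := (Set.countable_singleton 1).ae_notMem _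
  have key : HasSum (fun k : ℕ => ∫ t in (0 : ℝ)..1, (Real.log t : ℂ) * (z * (t : ℂ)) ^ k)
      (∫ t in (0 : ℝ)..1, (Real.log t : ℂ) / (1 - z * (t : ℂ))) := by
    apply intervalIntegral.hasSum_integral_of_dominated_convergence
      -- This bound sums to |log t|/(1-t), which is integrable without any gap between ‖z‖ and 1.
      (bound := fun k t => |Real.log t| * t ^ k)
    · intro k
      exact Measurable.aestronglyMeasurable (by fun_prop)
    · intro k
      refine Filter.Eventually.of_forall fun t ht => ?_
      rw [Set.uIoc_of_le zero_le_one] at ht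
      rw [norm_mul, norm_pow, norm_mul, Complex.norm_real, Complex.norm_real,
        Real.norm_of_nonneg ht.1.le, Real.norm_eq_abs]
      exact mul_le_mul_of_nonneg_left (pow_le_pow_left₀ (mul_nonneg (norm_nonneg z) ht.1.le)
        (mul_le_of_le_one_left ht.1.le hz) k) (abs_nonneg _)
    · filter_upwards [hae] with t ht1 ht
      rw [Set.uIoc_of_le zero_le_one] at ht
      exact (summable_geometric_of_lt_one ht.1.le (lt_of_le_of_ne ht.2 ht1)).mul_left _
    · refine intervalIntegrable_abs_log_div_one_sub.congr_ae ?_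
      refine (MeasureTheory.ae_restrict_iff' measurableSet_uIoc).2 ?_
      filter_upwards [hae] with t ht1 ht
      rw [Set.uIoc_of_le zero_le_one] at ht
      rw [tsum_mul_left, tsum_geometric_of_lt_one ht.1.le (lt_of_le_of_ne ht.2 ht1), div_eq_mul_inv]
    · filter_upwards [hae] with t ht1 ht
      rw [Set.uIoc_of_le zero_le_one] at ht
      rw [div_eq_mul_inv]
      apply HasSum.mul_left
      apply hasSum_geometric_of_norm_lt_one
      rw [norm_mul, Complex.norm_real, Real.norm_of_nonneg ht.1.le]
      exact (mul_le_of_le_one_left ht.1.le hz).trans_lt (lt_of_le_of_ne ht.2 ht1)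
  refine (key.mul_left (-z)).congr_fun fun k => ?_
  have h1 : ∀ t : ℝ, (Real.log t : ℂ) * (z * (t : ℂ)) ^ k
      = z ^ k * ((t ^ k * Real.log t : ℝ) : ℂ) := by
    intro t; push_cast; ring
  simp_rw [h1]
  rw [intervalIntegral.integral_const_mul, intervalIntegral.integral_ofReal,
    integral_pow_mul_log]
  push_cast
  ring

theorem dilog_zero : dilog 0 = 0 := by simp [dilog]

theorem dilog_one : dilog 1 = ((Real.pi ^ 2 / 6 : ℝ) : ℂ) := by
  refine (hasSum_dilog (by simp)).unique ?_
  have h := Complex.hasSum_ofReal.2 hasSum_one_div_succ_sq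
  refine h.congr_fun fun k => ?_
  push_cast
  simp

theorem dilog_neg_one : dilog (-1) = ((-Real.pi ^ 2 / 12 : ℝ) : ℂ) := by
  refine (hasSum_dilog (by simp)).unique ?_
  have h := Complex.hasSum_ofReal.2 hasSum_alternating_one_div_succ_sq
  refine h.congr_fun fun k => ?_
  push_cast
  simp

theorem hasSum_catalanG :
    HasSum (fun k : ℕ => (-1 : ℝ) ^ k / (2 * (k : ℝ) + 1) ^ 2) catalanG := by
  refine Summable.hasSum (summable_one_div_succ_sq.of_norm_bounded fun k => ?_)
  rw [norm_div, norm_pow, norm_neg, norm_one, one_pow, Real.norm_of_nonneg (by positivity)]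
  gcongr
  linarith [Nat.cast_nonneg (α := ℝ) k]

/-- Odd powers of -i give -iG; even powers give a quarter of the alternating sum -π²/12. -/
theorem dilog_neg_I : dilog (-Complex.I) = ((-Real.pi ^ 2 / 48 : ℝ) : ℂ) - catalanG * Complex.I := by
  have he := (Complex.hasSum_ofReal.2 hasSum_catalanG).mul_right (-Complex.I)
  have ho := (Complex.hasSum_ofReal.2 hasSum_alternating_one_div_succ_sq).div_const 4
  have h : HasSum (fun k : ℕ => (-Complex.I) ^ (k + 1) / ((k : ℂ) + 1) ^ 2)
      (catalanG * -Complex.I + ((-Real.pi ^ 2 / 12 : ℝ) : ℂ) / 4) := by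
    refine HasSum.even_add_odd (he.congr_fun fun k => ?_) (ho.congr_fun fun k => ?_)
    · rw [pow_succ, pow_mul, neg_sq, Complex.I_sq]
      push_cast
      ring
    · rw [show 2 * k + 1 + 1 = 2 * (k + 1) by ring, pow_mul, neg_sq, Complex.I_sq]
      have hk : (k : ℂ) + 1 ≠ 0 := Nat.cast_add_one_ne_zero k
      have h2 : 2 * (k : ℂ) + 1 + 1 = 2 * (k + 1) := by ring
      push_cast
      rw [h2]
      field_simp
      norm_num
  rw [(hasSum_dilog (by simp)).unique h]
  push_cast
  ring

/-! ### Logarithms and polylogarithms along 1 + iu -/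

/-- `u ↦ log (1 + i u)`. -/
noncomputable def logVert (u : ℝ) : ℂ := Complex.log (1 + u * Complex.I)

theorem one_add_mul_I_mem_slitPlane (u : ℝ) : 1 + u * Complex.I ∈ Complex.slitPlane :=
  Or.inl (by simp)

theorem hasDerivAt_one_add_mul_I (u : ℝ) :
    HasDerivAt (fun u : ℝ => 1 + u * Complex.I) Complex.I u := by
  simpa using ((Complex.ofRealCLM.hasDerivAt (x := u)).mul_const Complex.I).const_add 1

theorem hasDerivAt_logVert (u : ℝ) :
    HasDerivAt logVert (Complex.I / (1 + u * Complex.I)) u :=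
  (hasDerivAt_one_add_mul_I u).clog_real (one_add_mul_I_mem_slitPlane u)

theorem continuous_logVert : Continuous logVert :=
  continuous_iff_continuousAt.2 fun u => (hasDerivAt_logVert u).continuousAt

theorem logVert_zero : logVert 0 = 0 := by simp [logVert]

/-- log(1+iu) vanishes to first order at 0, so the product is a continuous slope times u log u. -/
theorem continuous_logVert_mul_log : Continuous fun u : ℝ => logVert u * (Real.log u : ℂ) := by
  have h : (fun u : ℝ => logVert u * (Real.log u : ℂ))
      = fun u : ℝ => dslope logVert 0 u * ((u * Real.log u : ℝ) : ℂ) := by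
    funext u
    have := sub_smul_dslope logVert 0 u
    rw [logVert_zero, sub_zero, sub_zero, Complex.real_smul] at this
    rw [← this]
    push_cast
    ring
  rw [h]
  refine Continuous.mul ?_ (Complex.continuous_ofReal.comp Real.continuous_mul_log)
  rw [continuous_iff_continuousAt]
  intro u
  rcases eq_or_ne u 0 with rfl | hu
  · exact continuousAt_dslope_same.2 (hasDerivAt_logVert 0).differentiableAt
  · exact (continuousAt_dslope_of_ne hu).2 continuous_logVert.continuousAt

theorem logVert_re (u : ℝ) : (logVert u).re = Real.log (1 + u ^ 2) / 2 := by
  rw [logVert, Complex.log_re, Complex.norm_def, Real.log_sqrt (Complex.normSq_nonneg _)]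
  congr 2
  simp [Complex.normSq_apply]
  ring

theorem hasDerivAt_logVert_im (u : ℝ) :
    HasDerivAt (fun u => (logVert u).im) (1 / (1 + u ^ 2)) u := by
  have h := Complex.imCLM.hasFDerivAt.comp_hasDerivAt u (hasDerivAt_logVert u)
  refine HasDerivAt.congr_deriv (f := fun u => (logVert u).im) h ?_
  simp [Complex.div_im, Complex.normSq_apply]
  ring

/-- The value of `log (-i u)` for `u > 0`. -/
noncomputable def logNegI (u : ℝ) : ℂ := Real.log u - Real.pi / 2 * Complex.I

theorem log_neg_mul_I {u : ℝ} (hu : 0 < u) : Complex.log (-(u * Complex.I)) = logNegI u := by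
  rw [← mul_neg, Complex.log_ofReal_mul hu (by simp), Complex.log_neg_I, logNegI]
  ring

theorem hasDerivAt_logNegI {u : ℝ} (hu : 0 < u) : HasDerivAt logNegI (1 / u : ℂ) u := by
  have := (Real.hasDerivAt_log hu.ne').ofReal_comp.sub_const (Real.pi / 2 * Complex.I : ℂ)
  exact this.congr_deriv (by push_cast; ring)

theorem continuous_logVert_mul_logNegI : Continuous fun u => logVert u * logNegI u := by
  simp only [logNegI, mul_sub]
  exact continuous_logVert_mul_log.sub (continuous_logVert.mul_const _)

theorem one_sub_one_add_mul_I_mem_slitPlane {u : ℝ} (hu : 0 < u) :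
    1 - (1 + u * Complex.I) ∈ Complex.slitPlane :=
  Or.inr (by simpa using hu.ne')

theorem one_add_mul_I_ne_zero (u : ℝ) : 1 + u * Complex.I ≠ 0 :=
  Complex.slitPlane_ne_zero (one_add_mul_I_mem_slitPlane u)

theorem hasDerivAt_dilog_one_add_mul_I {u : ℝ} (hu : 0 < u) :
    HasDerivAt (fun u : ℝ => dilog (1 + u * Complex.I))
      (-logNegI u / (1 + u * Complex.I) * Complex.I) u := by
  have h := (hasDerivAt_dilog (one_sub_one_add_mul_I_mem_slitPlane hu)
    (one_add_mul_I_ne_zero u)).comp u (hasDerivAt_one_add_mul_I u)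
  rw [show 1 - (1 + u * Complex.I) = -(u * Complex.I) by ring, log_neg_mul_I hu] at h
  exact h

theorem hasDerivAt_trilog_one_add_mul_I {u : ℝ} (hu : 0 < u) :
    HasDerivAt (fun u : ℝ => trilog (1 + u * Complex.I))
      (dilog (1 + u * Complex.I) / (1 + u * Complex.I) * Complex.I) u := by
  exact (hasDerivAt_trilog (one_sub_one_add_mul_I_mem_slitPlane hu)
    (one_add_mul_I_ne_zero u)).comp u (hasDerivAt_one_add_mul_I u)

theorem hasDerivAt_dilog_neg_mul_I {u : ℝ} (hu : 0 < u) :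
    HasDerivAt (fun u : ℝ => dilog (-(u * Complex.I))) (-logVert u / u) u := by
  have hu' : (u : ℂ) ≠ 0 := by exact_mod_cast hu.ne'
  have h1 : HasDerivAt (fun u : ℝ => -(u * Complex.I)) (-Complex.I) u := by
    simpa using! ((Complex.ofRealCLM.hasDerivAt (x := u)).mul_const Complex.I).neg
  have h := (hasDerivAt_dilog (z := -(u * Complex.I))
    (by rw [sub_neg_eq_add]; exact one_add_mul_I_mem_slitPlane u)
    (by simpa using hu.ne')).comp u h1
  rw [sub_neg_eq_add] at h
  refine h.congr_deriv ?_
  rw [logVert]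
  field_simp

theorem continuousOn_dilog_one_add_mul_I :
    ContinuousOn (fun u : ℝ => dilog (1 + u * Complex.I)) (Set.Icc 0 1) :=
  continuousOn_dilog_comp (by fun_prop) fun u _ t _ => one_sub_le_norm_one_sub_one_add_mul_I u t

theorem continuousOn_trilog_one_add_mul_I :
    ContinuousOn (fun u : ℝ => trilog (1 + u * Complex.I)) (Set.Icc 0 1) :=
  continuousOn_trilog_comp (by fun_prop) fun u _ t _ => one_sub_le_norm_one_sub_one_add_mul_I u t

theorem logVert_one : logVert 1 = Real.log 2 / 2 + Real.pi / 4 * Complex.I := by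
  have h : (1 : ℂ) + (1 : ℝ) * Complex.I
      = ((√2 : ℝ) : ℂ) * (Complex.cos ((Real.pi / 4 : ℝ) : ℂ)
        + Complex.sin ((Real.pi / 4 : ℝ) : ℂ) * Complex.I) := by
    rw [← Complex.ofReal_cos, ← Complex.ofReal_sin, Real.cos_pi_div_four, Real.sin_pi_div_four]
    have h2 : ((√2 : ℝ) : ℂ) * ((√2 : ℝ) : ℂ) = 2 := by
      rw [← Complex.ofReal_mul, Real.mul_self_sqrt (by norm_num)]
      norm_num
    push_cast
    linear_combination (-(1 + Complex.I) / 2) * h2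
  have him : (logVert 1).im = Real.pi / 4 := by
    rw [logVert, Complex.log_im, h, Complex.arg_mul_cos_add_sin_mul_I (by positivity)]
    constructor <;> linarith [Real.pi_pos]
  rw [← Complex.re_add_im (logVert 1), him, logVert_re]
  push_cast
  norm_num

/-- Euler's reflection Li₂(z) + Li₂(1-z) + log z log(1-z) = π²/6 along z = 1 + iu: the left side has
zero derivative for 0 < u < 1 and is continuous down to u = 0, where it is Li₂(1). -/
theorem dilog_one_add_I :
    dilog (1 + Complex.I)
      = ((Real.pi ^ 2 / 16 : ℝ) : ℂ)
        + (catalanG + Real.pi / 4 * Real.log 2) * Complex.I := by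
  set R : ℝ → ℂ := fun u => dilog (1 + u * Complex.I) + dilog (-(u * Complex.I))
    + logVert u * logNegI u with hR
  have hc : ContinuousOn R (Set.Icc 0 1) := by
    refine (continuousOn_dilog_one_add_mul_I.add (continuousOn_dilog_comp (by fun_prop) ?_)).add
      continuous_logVert_mul_logNegI.continuousOn
    intro u hu t ht
    refine one_sub_le_norm_one_sub_mul ?_ ht.1.le
    simpa [abs_of_nonneg hu.1] using hu.2
  have hd : ∀ u ∈ Set.Ioo (0 : ℝ) 1, HasDerivAt R 0 u := by
    intro u hu
    have h := ((hasDerivAt_dilog_one_add_mul_I hu.1).add (hasDerivAt_dilog_neg_mul_I hu.1)).add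
      ((hasDerivAt_logVert u).mul (hasDerivAt_logNegI hu.1))
    refine h.congr_deriv ?_
    ring
  have key := integral_eq_sub_of_hasDerivAt_of_le zero_le_one hc hd intervalIntegrable_const
  have h0 : R 0 = ((Real.pi ^ 2 / 6 : ℝ) : ℂ) := by
    simp [hR, logVert_zero, dilog_one, dilog_zero]
  have h1 : R 1 = dilog (1 + Complex.I) + dilog (-Complex.I) + logVert 1 * logNegI 1 := by
    simp [hR]
  rw [integral_zero, h0, h1, dilog_neg_I, logVert_one, logNegI] at key
  push_cast at key ⊢
  rw [Real.log_one] at key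
  push_cast at key
  linear_combination -key + ((Real.pi : ℂ) ^ 2 / 8) * Complex.I_sq

/-! ### Evaluation of S(0) -/

/-- Primitive of `log² (1 + i u) / (2 u)` on `(0, 1]`. -/
noncomputable def nielsenPrimitive (u : ℝ) : ℂ :=
  -trilog (1 + u * Complex.I) + logVert u * dilog (1 + u * Complex.I)
    + logVert u * (logVert u * logNegI u) / 2

/-- The Li₂ terms cancel between the first two summands, and the L·log(-iu) terms between the last
two; only L²/(2u), from the derivative of log(-iu), survives. -/
theorem hasDerivAt_nielsenPrimitive {u : ℝ} (hu : 0 < u) :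
    HasDerivAt nielsenPrimitive (logVert u ^ 2 / (2 * u)) u := by
  have hL := hasDerivAt_logVert u
  have h := ((hasDerivAt_trilog_one_add_mul_I hu).neg.add
    (hL.mul (hasDerivAt_dilog_one_add_mul_I hu))).add
    ((hL.mul (hL.mul (hasDerivAt_logNegI hu))).div_const 2)
  refine h.congr_deriv ?_
  have h1 := one_add_mul_I_ne_zero u
  have hu' : (u : ℂ) ≠ 0 := by exact_mod_cast hu.ne'
  simp only [Pi.mul_apply]
  field_simp
  ring

theorem continuousOn_nielsenPrimitive : ContinuousOn nielsenPrimitive (Set.Icc 0 1) :=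
  (continuousOn_trilog_one_add_mul_I.neg.add
    (continuous_logVert.continuousOn.mul continuousOn_dilog_one_add_mul_I)).add
    ((continuous_logVert.mul continuous_logVert_mul_logNegI).div_const 2).continuousOn

theorem hasDerivAt_dilog_neg_sq {u : ℝ} (hu : 0 < u) :
    HasDerivAt (fun u : ℝ => dilog (-(u : ℂ) ^ 2)) (-2 * ((Real.log (1 + u ^ 2) : ℝ) : ℂ) / u) u := by
  have hu' : (u : ℂ) ≠ 0 := by exact_mod_cast hu.ne'
  have h1 : HasDerivAt (fun u : ℝ => -(u : ℂ) ^ 2) (-(2 * u)) u := by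
    simpa using! ((Complex.ofRealCLM.hasDerivAt (x := u)).pow 2).neg
  have he : 1 - -(u : ℂ) ^ 2 = ((1 + u ^ 2 : ℝ) : ℂ) := by push_cast; ring
  have h := (hasDerivAt_dilog (z := -(u : ℂ) ^ 2)
    (by rw [he]; exact Complex.ofReal_mem_slitPlane.2 (by positivity))
    (by simpa using hu.ne')).comp u h1
  rw [he, ← Complex.ofReal_log (by positivity)] at h
  refine h.congr_deriv ?_
  field_simp

theorem continuousOn_dilog_neg_sq :
    ContinuousOn (fun u : ℝ => dilog (-(u : ℂ) ^ 2)) (Set.Icc 0 1) :=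
  continuousOn_dilog_comp (by fun_prop) fun u hu t ht =>
    one_sub_le_norm_one_sub_mul (by
      rw [norm_neg, norm_pow, Complex.norm_real, Real.norm_of_nonneg hu.1]
      exact pow_le_one₀ hu.1 hu.2) ht.1.le

theorem trilog_one_im : (trilog 1).im = 0 := by
  have h : ∀ t : ℝ, ((Real.log t ^ 2 : ℝ) : ℂ) / (1 - 1 * (t : ℂ))
      = ((Real.log t ^ 2 / (1 - t) : ℝ) : ℂ) := fun t => by push_cast; ring
  rw [trilog]
  simp_rw [h]
  rw [intervalIntegral.integral_ofReal]
  have : (1 : ℂ) / 2 = ((1 / 2 : ℝ) : ℂ) := by push_cast; ring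
  rw [this, ← Complex.ofReal_mul, Complex.ofReal_im]

theorem hasSum_dilog_neg_sq_re {u : ℝ} (h0 : 0 ≤ u) (h1 : u ≤ 1) :
    HasSum (fun k : ℕ => (-1 : ℝ) ^ (k + 1) / ((k : ℝ) + 1) ^ 2 * u ^ (2 * (k + 1)))
      (dilog (-(u : ℂ) ^ 2)).re := by
  have h := Complex.hasSum_re (hasSum_dilog (z := -(u : ℂ) ^ 2) (by
      rw [norm_neg, norm_pow, Complex.norm_real, Real.norm_of_nonneg h0]
      exact pow_le_one₀ h0 h1))
  refine h.congr_fun fun k => ?_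
  rw [show (-(u : ℂ) ^ 2) ^ (k + 1) / ((k : ℂ) + 1) ^ 2
    = (((-1 : ℝ) ^ (k + 1) / ((k : ℝ) + 1) ^ 2 * u ^ (2 * (k + 1)) : ℝ) : ℂ) by
      push_cast
      rw [neg_pow, pow_mul]
      ring]
  rw [Complex.ofReal_re]

/-- Termwise integration of Li₂(-u²) = ∑ (-1)^K u^(2K)/K², dominated by ∑ 1/K². -/
theorem momentSum_zero_eq_integral :
    momentSum 0 = ∫ u in (0 : ℝ)..1, (dilog (-(u : ℂ) ^ 2)).re / (1 + u ^ 2) := by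
  refine (hasSum_momentTerm 0).unique ?_
  have key := intervalIntegral.hasSum_integral_of_dominated_convergence
    (F := fun (k : ℕ) (u : ℝ) => (-1 : ℝ) ^ (k + 1) / ((k : ℝ) + 1) ^ 2
      * (u ^ (2 * (k + 1)) / (1 + u ^ 2)))
    (f := fun u : ℝ => (dilog (-(u : ℂ) ^ 2)).re / (1 + u ^ 2))
    (a := 0) (b := 1) (μ := MeasureTheory.volume)
    (fun k _ => 1 / ((k : ℝ) + 1) ^ 2)
    (fun k => Measurable.aestronglyMeasurable (by fun_prop))
    (fun k => Filter.Eventually.of_forall fun u hu => by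
      rw [Set.uIoc_of_le zero_le_one] at hu
      have hu0 := hu.1
      rw [norm_mul, norm_div, norm_pow, norm_neg, norm_one, one_pow,
        Real.norm_of_nonneg (by positivity : 0 ≤ ((k : ℝ) + 1) ^ 2),
        Real.norm_of_nonneg (by positivity : 0 ≤ u ^ (2 * (k + 1)) / (1 + u ^ 2))]
      refine mul_le_of_le_one_right (by positivity) ?_
      rw [div_le_one (by positivity)]
      have := pow_le_one₀ (n := 2 * (k + 1)) hu0.le hu.2
      nlinarith)
    (Filter.Eventually.of_forall fun u _ => summable_one_div_succ_sq)
    intervalIntegrable_const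
    (Filter.Eventually.of_forall fun u hu => by
      rw [Set.uIoc_of_le zero_le_one] at hu
      simpa only [mul_div_assoc] using
        (hasSum_dilog_neg_sq_re hu.1.le hu.2).div_const (1 + u ^ 2))
  refine key.congr_fun fun k => ?_
  rw [intervalIntegral.integral_const_mul, momentTerm, arctanMoment, add_zero]

theorem momentSum_zero :
    momentSum 0 = Real.pi / 4 * Real.log 2 ^ 2 + 5 * Real.pi ^ 3 / 48
      + 2 * catalanG * Real.log 2 - 4 * (trilog (1 + Complex.I)).im := by
  -- Im L² = 2 Re L Im L = log(1+u²) Im L, so four times the imaginary part of L²/(2u) cancels Im L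
  -- · (d/du) Li₂(-u²). What remains is the integrand, since (Im L)' = 1/(1+u²).
  set H : ℝ → ℝ := fun u => (logVert u).im * (dilog (-(u : ℂ) ^ 2)).re
    + 4 * (nielsenPrimitive u).im with hH
  have hre : ContinuousOn (fun u : ℝ => (dilog (-(u : ℂ) ^ 2)).re) (Set.Icc 0 1) :=
    Complex.continuous_re.comp_continuousOn continuousOn_dilog_neg_sq
  have hc : ContinuousOn H (Set.Icc 0 1) :=
    ((Complex.continuous_im.comp continuous_logVert).continuousOn.mul hre).add
      ((Complex.continuous_im.comp_continuousOn continuousOn_nielsenPrimitive).const_mul 4)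
  have hd : ∀ u ∈ Set.Ioo (0 : ℝ) 1,
      HasDerivAt H ((dilog (-(u : ℂ) ^ 2)).re / (1 + u ^ 2)) u := by
    intro u hu
    have h1 := Complex.reCLM.hasFDerivAt.comp_hasDerivAt u (hasDerivAt_dilog_neg_sq hu.1)
    have h2 := Complex.imCLM.hasFDerivAt.comp_hasDerivAt u (hasDerivAt_nielsenPrimitive hu.1)
    have h := ((hasDerivAt_logVert_im u).mul h1).add (h2.const_mul 4)
    refine HasDerivAt.congr_deriv (f := H) h ?_
    have e1 : -2 * ((Real.log (1 + u ^ 2) : ℝ) : ℂ) / u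
        = ((-2 * Real.log (1 + u ^ 2) / u : ℝ) : ℂ) := by push_cast; ring
    have e2 : logVert u ^ 2 / (2 * u) = logVert u ^ 2 * (((2 * u)⁻¹ : ℝ) : ℂ) := by
      push_cast; rw [div_eq_mul_inv]
    have hu0 := hu.1.ne'
    have hu1 : 1 + u ^ 2 ≠ 0 := by positivity
    simp only [Function.comp_apply, Complex.reCLM_apply, Complex.imCLM_apply]
    rw [e1, e2, Complex.ofReal_re, Complex.im_mul_ofReal, sq (logVert u), Complex.mul_im,
      logVert_re]
    field_simp
    ring
  have hi : IntervalIntegrable (fun u : ℝ => (dilog (-(u : ℂ) ^ 2)).re / (1 + u ^ 2))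
      MeasureTheory.volume 0 1 :=
    (hre.div (by fun_prop) fun u _ => by positivity).intervalIntegrable_of_Icc zero_le_one
  have key := integral_eq_sub_of_hasDerivAt_of_le zero_le_one hc hd hi
  -- At u = 0 the primitive is -Li₃(1), which is real.
  have h0 : H 0 = 0 := by
    simp [hH, nielsenPrimitive, logVert_zero, trilog_one_im]
  have hn : nielsenPrimitive 1 = -trilog (1 + Complex.I)
      + ((Real.log 2 * Real.pi ^ 2 / 32 - Real.pi / 4 * (catalanG + Real.pi / 4 * Real.log 2)
        + Real.pi ^ 2 * Real.log 2 / 16 : ℝ) : ℂ)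
      + ((Real.log 2 / 2 * (catalanG + Real.pi / 4 * Real.log 2) + Real.pi ^ 3 / 64
        - Real.pi / 4 * (Real.log 2 ^ 2 / 4 - Real.pi ^ 2 / 16) : ℝ) : ℂ) * Complex.I := by
    rw [nielsenPrimitive, Complex.ofReal_one, one_mul, dilog_one_add_I, logVert_one, logNegI,
      Real.log_one]
    push_cast
    linear_combination ((Real.pi : ℂ) / 4 * (catalanG + Real.pi / 4 * Real.log 2)
      - (Real.log 2 * Real.pi ^ 2 / 16 : ℂ) - (Real.pi : ℂ) ^ 3 / 64 * Complex.I) * Complex.I_sq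
  have h1 : H 1 = Real.pi / 4 * (-Real.pi ^ 2 / 12) + 4 * (-(trilog (1 + Complex.I)).im
      + (Real.log 2 / 2 * (catalanG + Real.pi / 4 * Real.log 2) + Real.pi ^ 3 / 64
        - Real.pi / 4 * (Real.log 2 ^ 2 / 4 - Real.pi ^ 2 / 16))) := by
    have hl : (logVert 1).im = Real.pi / 4 := by
      rw [logVert_one, show (Real.log 2 / 2 + Real.pi / 4 * Complex.I : ℂ)
        = ((Real.log 2 / 2 : ℝ) : ℂ) + ((Real.pi / 4 : ℝ) : ℂ) * Complex.I by push_cast; ring]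
      rw [Complex.add_im, Complex.ofReal_im, Complex.im_ofReal_mul, Complex.I_im]
      ring
    simp only [hH]
    rw [hn, hl, Complex.ofReal_one, one_pow, dilog_neg_one, Complex.ofReal_re, Complex.add_im,
      Complex.add_im, Complex.ofReal_im, Complex.im_ofReal_mul, Complex.I_im, Complex.neg_im]
    ring
  rw [momentSum_zero_eq_integral, key, h0, h1]
  ring

end

/-! ### Assembling the four cases -/

theorem theorem9 (m n : ℕ) (hm : 1 ≤ m) (hmn : m ≤ n) :
    (n = m → HasTheta2Sum n (2 * m)
      ((-1) ^ m * (-4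
        - ∑ k ∈ Finset.Icc 1 m, ∑ j ∈ Finset.Icc 0 k,
            (-1 : ℝ) ^ j / ((k : ℝ) ^ 2 * (2 * (j : ℝ) + 1))
        + (1 + ∑ k ∈ Finset.Icc 1 m, 1 / (4 * (k : ℝ) ^ 2)) * Real.pi
        + 2 * Real.log 2 - Real.pi / 4 * Real.log 2 ^ 2 - Real.pi ^ 2 / 12
        - 5 * Real.pi ^ 3 / 48 - 2 * catalanG * Real.log 2
        + 4 * (trilog (1 + Complex.I)).im)))
    ∧ (n = m + 1 → HasTheta2Sum n (2 * m)
      ((-1) ^ m * (116 / 27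
        + ∑ k ∈ Finset.Icc 1 m, ∑ j ∈ Finset.Icc 0 (k + 1),
            (-1 : ℝ) ^ j / ((k : ℝ) ^ 2 * (2 * (j : ℝ) + 1))
        - (10 / 9 + ∑ k ∈ Finset.Icc 1 m, 1 / (4 * (k : ℝ) ^ 2)) * Real.pi
        - 16 * Real.log 2 / 9 + Real.pi / 4 * Real.log 2 ^ 2 + Real.pi ^ 2 / 18
        + 5 * Real.pi ^ 3 / 48 + 2 * catalanG * Real.log 2
        - 4 * (trilog (1 + Complex.I)).im)))
    ∧ (Odd (n - m) → n - m ≠ 1 → HasTheta2Sum n (2 * m)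
      ((-1) ^ m * (116 / 27
        - 4 * ∑ j ∈ Finset.Icc 1 ((n - m - 1) / 2), 1 / (4 * (j : ℝ) + 3) ^ 3
        - ∑ k ∈ Finset.Icc 1 m, ∑ j ∈ Finset.Icc 0 (k + (n - m)),
            (-1 : ℝ) ^ (j + (n - m)) / ((k : ℝ) ^ 2 * (2 * (j : ℝ) + 1))
        + 8 * ∑ k ∈ Finset.Icc 1 ((n - m - 1) / 2), ∑ j ∈ Finset.Icc 0 (2 * k),
            (-1 : ℝ) ^ j * (16 * (k : ℝ) ^ 2 + 16 * (k : ℝ) + 5)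
              / ((2 * (j : ℝ) + 1) * (4 * (k : ℝ) + 3) ^ 2 * (4 * (k : ℝ) + 1) ^ 2)
        + (-(10 / 9)
            - ∑ j ∈ Finset.Icc 1 ((n - m - 1) / 2),
                2 * (16 * (j : ℝ) ^ 2 + 16 * (j : ℝ) + 5)
                  / ((4 * (j : ℝ) + 3) ^ 2 * (4 * (j : ℝ) + 1) ^ 2)
            + 1 / 4 * Real.log 2 ^ 2
            + ∑ k ∈ Finset.Icc 1 m, (-1 : ℝ) ^ (n - m) / (4 * (k : ℝ) ^ 2)) * Real.pi
        - (1 / 9 + ∑ j ∈ Finset.Icc 1 ((n - m - 1) / 2),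
              (2 * (j : ℝ) + 1) / ((4 * (j : ℝ) + 3) ^ 2 * (4 * (j : ℝ) + 1) ^ 2))
            * (16 * Real.log 2)
        + (1 / 18 + 1 / 6 * ∑ j ∈ Finset.Icc 1 ((n - m - 1) / 2),
              1 / ((4 * (j : ℝ) + 3) * (4 * (j : ℝ) + 1))) * Real.pi ^ 2
        + 5 * Real.pi ^ 3 / 48 + 2 * catalanG * Real.log 2
        - 4 * (trilog (1 + Complex.I)).im)))
    -- the sums over `0 ≤ j ≤ (n - m - 2) / 2` are sums over `j < (n - m) / 2`, empty for `n = m`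
    ∧ (Even (n - m) → HasTheta2Sum n (2 * m)
      ((-1) ^ m * (-4
        - 4 * ∑ j ∈ Finset.range ((n - m) / 2), 1 / (4 * (j : ℝ) + 5) ^ 3
        - ∑ k ∈ Finset.Icc 1 m, ∑ j ∈ Finset.Icc 0 (k + (n - m)),
            (-1 : ℝ) ^ (j + (n - m)) / ((k : ℝ) ^ 2 * (2 * (j : ℝ) + 1))
        - 8 * ∑ k ∈ Finset.range ((n - m) / 2), ∑ j ∈ Finset.Icc 0 (2 * k + 1),
            (-1 : ℝ) ^ j * (16 * (k : ℝ) ^ 2 + 32 * (k : ℝ) + 17)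
              / ((2 * (j : ℝ) + 1) * (4 * (k : ℝ) + 5) ^ 2 * (4 * (k : ℝ) + 3) ^ 2)
        + (1
            + ∑ j ∈ Finset.range ((n - m) / 2),
                2 * (16 * (j : ℝ) ^ 2 + 32 * (j : ℝ) + 17)
                  / ((4 * (j : ℝ) + 5) ^ 2 * (4 * (j : ℝ) + 3) ^ 2)
            - 1 / 4 * Real.log 2 ^ 2
            + ∑ k ∈ Finset.Icc 1 m, (-1 : ℝ) ^ (n - m) / (4 * (k : ℝ) ^ 2)) * Real.pi
        + (1 - 16 * ∑ j ∈ Finset.range ((n - m) / 2),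
              ((j : ℝ) + 1) / ((4 * (j : ℝ) + 5) ^ 2 * (4 * (j : ℝ) + 3) ^ 2))
            * (2 * Real.log 2)
        + (-(1 / 2) + ∑ j ∈ Finset.range ((n - m) / 2),
              1 / ((4 * (j : ℝ) + 5) * (4 * (j : ℝ) + 3))) * (Real.pi ^ 2 / 6)
        - 5 * Real.pi ^ 3 / 48 - 2 * catalanG * Real.log 2
        + 4 * (trilog (1 + Complex.I)).im))) := by
  obtain ⟨d, rfl⟩ := Nat.exists_eq_add_of_le hmn
  have hs := hasTheta2Sum_momentSum m d
  rw [sum_momentTerm] at hs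
  simp only [Nat.add_sub_cancel_left]
  refine ⟨fun h => ?_, fun h => ?_, fun h _ => ?_, fun h => ?_⟩
  · obtain rfl : d = 0 := by omega
    have hv := momentSum_two_mul_add_one 0
    simp only [mul_zero, zero_add, Finset.sum_range_zero] at hv
    rw [zero_add, hv, momentSum_zero] at hs
    convert hs using 2
    simp only [add_zero, pow_zero]
    ring
  · obtain rfl : d = 1 := by omega
    have hv := momentSum_two_mul_add_two 0
    simp only [mul_zero, zero_add] at hv
    rw [hv, momentSum_zero] at hs
    convert hs using 2
    simp [pow_succ, neg_div]
    ring
  -- For d = 2r+1 the required sum is S(2r+2), in which S(0) enters with sign +.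
  · obtain ⟨r, rfl⟩ := h
    rw [momentSum_two_mul_add_two, momentSum_zero] at hs
    rw [show (2 * r + 1 - 1) / 2 = r by omega]
    convert hs using 2
    ring
  -- For d = 2r the required sum is S(2r+1), in which S(0) enters with sign -.
  · obtain ⟨r, rfl⟩ := h
    rw [← two_mul, momentSum_two_mul_add_one, momentSum_zero] at hs
    rw [← two_mul, show 2 * r / 2 = r by omega]
    convert hs using 2
    ring
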